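/- Let $(M^{2n},\omega,\theta)$ be a locally conformal symplectic manifold: $M$ is a smooth manifold of dimension $2n$, $\omega$ is a non-degenerate $2$-form and $\theta$ a closed $1$-form on $M$ with $d\omega=-\omega\wedge\theta$. For an integer $l$ let $d_l\alpha=d\alpha+l\,\theta\wedge\alpha$, a differential on the space $\Omega^*(M)$ of smooth differential forms, and let $H^*_l(M)$ be the cohomology of $(\Omega^*(M),d_l)$. Put $L\alpha=\omega\wedge\alpha$ and filter $\Omega^*(M)$ by the subcomplexes $F^p=L^p\,\Omega^*(M)$, $p\ge 0$. Let $$\bigl(E^{p,q}_{l,r},\ d_{l,r}:E^{p,q}_{l,r}\to E^{p+r,\,q-r+1}_{l,r}\bigr)$$ be the spectral sequence of the filtered complex $(F^*,d_l)$. Assume that $\omega^T=d_T\rho$ for some integer $T\ge 2$ and some $\rho\in\Omega^{2T-1}(M)$ (for instance, that $T\ge 2$ is the minimal number for which such a $\rho$ exists). Then, for every integer $l$, the spectral sequence stabilizes at the term $E_{l,T+1}$: for all $r\ge T+1$ one has $d_{l,r}=0$, and $E^{p,q}_{l,r}$ is canonically isomorphic to $F^pH^{p+q}_l(M)/F^{p+1}H^{p+q}_l(M)$,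 where $F^pH^k_l(M)$ is the set of classes of $d_l$-closed $k$-forms lying in $F^p$; in particular $E_{l,T+1}=E_{l,T+2}=\dots=E_{l,\infty}$. -/

import Mathlib

open scoped Manifold ContDiff Nat

noncomputable section
namespace LCS

set_option linter.unusedSectionVars false

/-! ### The exterior product of alternating forms on a vector space -/

section Wedge

variable {V W : Type*} [AddCommGroup V] [Module ℝ V] [TopologicalSpace V]
  [AddCommGroup W] [Module ℝ W] [TopologicalSpace W] {k l : ℕ}

lemma update_castAdd (v : Fin (k + l) → V) (i : Fin k) (z : V) :
    (fun i' => Function.update v (Fin.castAdd l i) z (Fin.castAdd l i')) =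
        Function.update (fun i' => v (Fin.castAdd l i')) i z ∧
      (fun j => Function.update v (Fin.castAdd l i) z (Fin.natAdd k j)) =
        fun j => v (Fin.natAdd k j) := by
  constructor
  · ext i'
    by_cases h : i' = i
    · subst h; simp
    · simp [Function.update, h]
  · ext j
    rw [Function.update_of_ne]
    intro h
    have := congrArg Fin.val h
    simp at this
    omega

lemma update_natAdd (v : Fin (k + l) → V) (j : Fin l) (z : V) :
    (fun j' => Function.update v (Fin.natAdd k j) z (Fin.natAdd k j')) =
        Function.update (fun j' => v (Fin.natAdd k j')) j z ∧
      (fun i => Function.update v (Fin.natAdd k j) z (Fin.castAdd l i)) =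
        fun i => v (Fin.castAdd l i) := by
  constructor
  · ext j'
    by_cases h : j' = j
    · subst h; simp
    · simp [Function.update, h]
  · ext i
    rw [Function.update_of_ne]
    intro h
    have := congrArg Fin.val h
    simp at this
    omega

/-- The tensor product `α ⊗ β` of two alternating forms, a multilinear form in `k + l` arguments:
`(α ⊗ β)(v₁, …, v_{k+l}) = α(v₁, …, v_k) β(v_{k+1}, …, v_{k+l})`. -/
def tensorForm (α : V [⋀^Fin k]→L[ℝ] ℝ) (β : V [⋀^Fin l]→L[ℝ] ℝ) :
    ContinuousMultilinearMap ℝ (fun _ : Fin (k + l) => V) ℝ where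
  toFun v := α (fun i => v (Fin.castAdd l i)) * β (fun j => v (Fin.natAdd k j))
  map_update_add' := by
    intro dec v i x y
    obtain rfl : dec = instDecidableEqFin (k + l) := Subsingleton.elim _ _
    refine Fin.addCases (fun i => ?_) (fun j => ?_) i
    · simp only [(update_castAdd v i _).1, (update_castAdd v i _).2, α.map_update_add]; ring
    · simp only [(update_natAdd v j _).1, (update_natAdd v j _).2, β.map_update_add]; ring
  map_update_smul' := by
    intro dec v i c x
    obtain rfl : dec = instDecidableEqFin (k + l) := Subsingleton.elim _ _
    refine Fin.addCases (fun i => ?_) (fun j => ?_) i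
    · simp only [(update_castAdd v i _).1, (update_castAdd v i _).2, α.map_update_smul,
        smul_eq_mul]; ring
    · simp only [(update_natAdd v j _).1, (update_natAdd v j _).2, β.map_update_smul,
        smul_eq_mul]; ring
  cont := by
    exact (α.cont.comp (by fun_prop : Continuous fun (v : Fin (k + l) → V) (i : Fin k) =>
      v (Fin.castAdd l i))).mul (β.cont.comp (by fun_prop :
      Continuous fun (v : Fin (k + l) → V) (i : Fin l) => v (Fin.natAdd k i)))

lemma tensorForm_apply (α : V [⋀^Fin k]→L[ℝ] ℝ) (β : V [⋀^Fin l]→L[ℝ] ℝ)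
    (v : Fin (k + l) → V) : tensorForm α β v =
      α (fun i => v (Fin.castAdd l i)) * β (fun j => v (Fin.natAdd k j)) := rfl

/-- The exterior product `α ∧ β` of alternating forms of degrees `k` and `l`,
`(α ∧ β)(v₁, …, v_{k+l}) = 1/(k! l!) ∑_σ sgn(σ) α(v_{σ1}, …, v_{σk}) β(v_{σ(k+1)}, …, v_{σ(k+l)})`,
the sum running over all permutations `σ`; equivalently, the sum over all `(k,l)`-shuffles. -/
def wedge (α : V [⋀^Fin k]→L[ℝ] ℝ) (β : V [⋀^Fin l]→L[ℝ] ℝ) : V [⋀^Fin (k + l)]→L[ℝ] ℝ :=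
  ((k ! * l ! : ℝ)⁻¹) • ContinuousMultilinearMap.alternatization (tensorForm α β)

lemma wedge_apply (α : V [⋀^Fin k]→L[ℝ] ℝ) (β : V [⋀^Fin l]→L[ℝ] ℝ) (v : Fin (k + l) → V) :
    wedge α β v = ((k ! * l ! : ℝ)⁻¹) * ∑ σ : Equiv.Perm (Fin (k + l)),
      ((Equiv.Perm.sign σ : ℤ) : ℝ) * (α (fun i => v (σ (Fin.castAdd l i))) *
        β (fun j => v (σ (Fin.natAdd k j)))) := by
  simp [wedge, ContinuousMultilinearMap.alternatization_apply_apply, tensorForm_apply,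
    Units.smul_def]

lemma wedge_add_left (α α' : V [⋀^Fin k]→L[ℝ] ℝ) (β : V [⋀^Fin l]→L[ℝ] ℝ) :
    wedge (α + α') β = wedge α β + wedge α' β := by
  ext v
  simp only [wedge_apply, ContinuousAlternatingMap.add_apply, ← mul_add, ← Finset.sum_add_distrib]
  congr 1; refine Finset.sum_congr rfl fun σ _ => ?_; ring

lemma wedge_add_right (α : V [⋀^Fin k]→L[ℝ] ℝ) (β β' : V [⋀^Fin l]→L[ℝ] ℝ) :
    wedge α (β + β') = wedge α β + wedge α β' := by
  ext v
  simp only [wedge_apply, ContinuousAlternatingMap.add_apply, ← mul_add, ← Finset.sum_add_distrib]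

lemma wedge_smul_left (c : ℝ) (α : V [⋀^Fin k]→L[ℝ] ℝ) (β : V [⋀^Fin l]→L[ℝ] ℝ) :
    wedge (c • α) β = c • wedge α β := by
  ext v
  simp only [wedge_apply, ContinuousAlternatingMap.smul_apply, smul_eq_mul, Finset.mul_sum]
  refine Finset.sum_congr rfl fun σ _ => ?_; ring

lemma wedge_smul_right (c : ℝ) (α : V [⋀^Fin k]→L[ℝ] ℝ) (β : V [⋀^Fin l]→L[ℝ] ℝ) :
    wedge α (c • β) = c • wedge α β := by
  ext v
  simp only [wedge_apply, ContinuousAlternatingMap.smul_apply, smul_eq_mul, Finset.mul_sum]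
  refine Finset.sum_congr rfl fun σ _ => ?_; ring

lemma wedge_comp (α : V [⋀^Fin k]→L[ℝ] ℝ) (β : V [⋀^Fin l]→L[ℝ] ℝ) (f : W →L[ℝ] V) :
    (wedge α β).compContinuousLinearMap f =
      wedge (α.compContinuousLinearMap f) (β.compContinuousLinearMap f) := by
  ext v
  simp [wedge_apply, Function.comp_def]

lemma bij_perm (k : ℕ) : Function.Bijective (fun p : Fin (k + 1) × Equiv.Perm (Fin k) =>
    (p.1.cycleRange.symm * Equiv.Perm.decomposeFin.symm (0, p.2) : Equiv.Perm (Fin (k + 1)))) := by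
  rw [Fintype.bijective_iff_injective_and_card]
  constructor
  · rintro ⟨i, e⟩ ⟨j, f⟩ h
    have h0 := DFunLike.congr_fun h 0
    simp at h0
    subst h0
    simpa using h
  · simp [Fintype.card_perm, Nat.factorial_succ]

lemma sum_perm_succ (k : ℕ) (a : V → ℝ) (β : V [⋀^Fin k]→L[ℝ] ℝ) (v : Fin (k + 1) → V) :
    ∑ σ : Equiv.Perm (Fin (k + 1)), ((Equiv.Perm.sign σ : ℤ) : ℝ) *
      (a (v (σ 0)) * β (fun j => v (σ j.succ))) =
    (k ! : ℝ) * ∑ i : Fin (k + 1), (-1) ^ (i : ℕ) * (a (v i) * β (i.removeNth v)) := by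
  rw [← (bij_perm k).sum_comp, Fintype.sum_prod_type, Finset.mul_sum]
  refine Finset.sum_congr rfl fun i _ => ?_
  have : ∀ e : Equiv.Perm (Fin k), ((Equiv.Perm.sign (i.cycleRange.symm * Equiv.Perm.decomposeFin.symm (0, e) : Equiv.Perm (Fin (k + 1))) : ℤ) : ℝ) *
      (a (v ((i.cycleRange.symm * Equiv.Perm.decomposeFin.symm (0, e) : Equiv.Perm (Fin (k + 1))) 0)) * β (fun j => v ((i.cycleRange.symm * Equiv.Perm.decomposeFin.symm (0, e) : Equiv.Perm (Fin (k + 1))) j.succ))) = (-1) ^ (i : ℕ) * (a (v i) * β (i.removeNth v)) := by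
    intro e
    have h := β.toAlternatingMap.map_perm (i.removeNth v) e
    have h2 : (fun j => v ((i.cycleRange.symm * Equiv.Perm.decomposeFin.symm (0, e) : Equiv.Perm (Fin (k + 1))) j.succ)) = i.removeNth v ∘ e := by
      ext j; simp [Fin.removeNth]
    rw [h2]
    have h3 : β (i.removeNth v ∘ e) = ((Equiv.Perm.sign e : ℤ) : ℝ) * β (i.removeNth v) := by
      simpa [Units.smul_def] using h
    rw [h3]
    have h4 : ((Equiv.Perm.sign e : ℤ) : ℝ) * ((Equiv.Perm.sign e : ℤ) : ℝ) = 1 := by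
      rw [← Int.cast_mul]; simp [← Units.val_mul]
    simp [Equiv.Perm.decomposeFin.symm_sign]
    linear_combination ((-1) ^ (i : ℕ) * (a (v i) * β (i.removeNth v))) * h4
  simp only [this]
  simp [Fintype.card_perm]

/-- Transport of a form along an equality of degrees (it does not change the form). -/
def castForm (h : k = l) (α : V [⋀^Fin k]→L[ℝ] ℝ) : V [⋀^Fin l]→L[ℝ] ℝ :=
  h ▸ α

lemma castForm_apply (h : k = l) (α : V [⋀^Fin k]→L[ℝ] ℝ) (v : Fin l → V) :
    castForm h α v = α (fun i => v (Fin.cast h i)) := by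
  subst h; rfl

lemma castForm_comp (h : k = l) (α : V [⋀^Fin k]→L[ℝ] ℝ) (f : W →L[ℝ] V) :
    castForm h (α.compContinuousLinearMap f) = (castForm h α).compContinuousLinearMap f := by
  subst h; rfl

/-- `(θ ∧ α)(v₀, …, v_k) = ∑ᵢ (-1)ⁱ θ(vᵢ) α(v₀, …, v̂ᵢ, …, v_k)` for a `1`-form `θ`. -/
lemma wedge_one (θ : V [⋀^Fin 1]→L[ℝ] ℝ) (α : V [⋀^Fin k]→L[ℝ] ℝ) (v : Fin (k + 1) → V) :
    castForm (Nat.add_comm 1 k) (wedge θ α) v =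
      ∑ i : Fin (k + 1), (-1) ^ (i : ℕ) * (θ (fun _ => v i) * α (i.removeNth v)) := by
  have key := sum_perm_succ k (fun x => θ (fun _ => x)) α v
  have hk : (k ! : ℝ) ≠ 0 := by positivity
  rw [castForm_apply, wedge_apply]
  rw [← Equiv.sum_comp (Equiv.permCongr (finCongr (Nat.add_comm k 1)))]
  rw [← mul_right_inj' hk, ← key]
  simp only [Nat.factorial_one, Nat.cast_one, one_mul]
  rw [← mul_assoc, mul_inv_cancel₀ hk, one_mul]
  refine Finset.sum_congr rfl fun σ _ => ?_
  rw [Equiv.Perm.sign_permCongr]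
  congr 2
  · congr 1; ext i; fin_cases i; simp; congr 2
  · congr 1; ext j; simp

end Wedge

/-! ### Differential forms on a manifold -/

section Forms

variable {E : Type*} [NormedAddCommGroup E] [NormedSpace ℝ E]

lemma norm_wedge_le {k l : ℕ} (α : E [⋀^Fin k]→L[ℝ] ℝ) (β : E [⋀^Fin l]→L[ℝ] ℝ) :
    ‖wedge α β‖ ≤ ((k ! * l ! : ℝ)⁻¹ * ((k + l)! : ℝ)) * ‖α‖ * ‖β‖ := by
  refine ContinuousAlternatingMap.opNorm_le_bound (f := wedge α β) (by positivity) fun v => ?_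
  rw [wedge_apply, norm_mul, Real.norm_of_nonneg (by positivity), mul_assoc, mul_assoc, mul_assoc]
  refine mul_le_mul_of_nonneg_left ?_ (by positivity)
  refine (norm_sum_le _ _).trans ?_
  have : ∀ σ : Equiv.Perm (Fin (k + l)), ‖((Equiv.Perm.sign σ : ℤ) : ℝ) *
      (α (fun i => v (σ (Fin.castAdd l i))) * β (fun j => v (σ (Fin.natAdd k j))))‖ ≤
      ‖α‖ * (‖β‖ * ∏ i, ‖v i‖) := by
    intro σ
    have h1 : ‖((Equiv.Perm.sign σ : ℤ) : ℝ)‖ = 1 := by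
      rcases Int.units_eq_one_or (Equiv.Perm.sign σ) with h | h <;> simp [h]
    rw [norm_mul, h1, one_mul, norm_mul, ← Equiv.prod_comp σ, Fin.prod_univ_add]
    calc _ ≤ (‖α‖ * ∏ i, ‖v (σ (Fin.castAdd l i))‖) * (‖β‖ * ∏ j, ‖v (σ (Fin.natAdd k j))‖) :=
          mul_le_mul (α.le_opNorm _) (β.le_opNorm _) (norm_nonneg _) (by positivity)
      _ = _ := by ring
  refine (Finset.sum_le_sum fun σ _ => this σ).trans ?_
  simp [Fintype.card_perm]

/-- The exterior product on a normed space, as a continuous bilinear map. -/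
def wedgeCLM (E : Type*) [NormedAddCommGroup E] [NormedSpace ℝ E] (k l : ℕ) :
    (E [⋀^Fin k]→L[ℝ] ℝ) →L[ℝ] (E [⋀^Fin l]→L[ℝ] ℝ) →L[ℝ] (E [⋀^Fin (k + l)]→L[ℝ] ℝ) :=
  LinearMap.mkContinuous₂
    (LinearMap.mk₂ ℝ wedge wedge_add_left wedge_smul_left wedge_add_right wedge_smul_right)
    _ norm_wedge_le

lemma wedgeCLM_apply {k l : ℕ} (α : E [⋀^Fin k]→L[ℝ] ℝ) (β : E [⋀^Fin l]→L[ℝ] ℝ) :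
    wedgeCLM E k l α β = wedge α β := rfl

variable {M : Type*} [TopologicalSpace M] [ChartedSpace E M]

/-- The local representation, in the chart at `x₀`, of a field `α` of alternating `k`-forms on the
tangent spaces of `M`: its pull-back along the inverse of the chart, a function on (the target of
the chart in) the model space `E` with values in the alternating `k`-forms on `E`. -/
def rep {k : ℕ} (α : ∀ x : M, TangentSpace 𝓘(ℝ, E) x [⋀^Fin k]→L[ℝ] ℝ) (x₀ : M) (y : E) :
    E [⋀^Fin k]→L[ℝ] ℝ :=
  (α ((extChartAt 𝓘(ℝ, E) x₀).symm y)).compContinuousLinearMap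
    (mfderiv 𝓘(ℝ, E) 𝓘(ℝ, E) (extChartAt 𝓘(ℝ, E) x₀).symm y)

variable (E M) in
/-- The real vector space of smooth `k`-forms on `M`: fields of alternating `k`-forms on the tangent
spaces whose local representations in the charts are smooth. -/
def smoothForms (k : ℕ) : Submodule ℝ (∀ x : M, TangentSpace 𝓘(ℝ, E) x [⋀^Fin k]→L[ℝ] ℝ) where
  carrier := {α | ∀ x₀ : M, ContDiffOn ℝ ∞ (rep α x₀) (extChartAt 𝓘(ℝ, E) x₀).target}
  zero_mem' := fun _ => contDiffOn_const (c := 0)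
  add_mem' := fun ha hb x₀ => (ha x₀).add (hb x₀)
  smul_mem' := fun c _ ha x₀ => (ha x₀).const_smul c

variable (E M) in
/-- The space `Ω^k(M)` of smooth differential `k`-forms on the manifold `M` modelled on `E`. -/
abbrev Form (k : ℕ) : Type _ := smoothForms E M k

variable {k l : ℕ}

lemma contDiffOn_rep (α : Form E M k) (x₀ : M) :
    ContDiffOn ℝ ∞ (rep α.1 x₀) (extChartAt 𝓘(ℝ, E) x₀).target := α.2 x₀

/-- The exterior product of differential forms. -/
def Form.wedge (α : Form E M k) (β : Form E M l) : Form E M (k + l) :=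
  ⟨fun x => LCS.wedge (α.1 x) (β.1 x), fun x₀ => by
    have : rep (fun x => LCS.wedge (α.1 x) (β.1 x)) x₀ =
        fun y => wedgeCLM E k l (rep α.1 x₀ y) (rep β.1 x₀ y) := by
      funext y
      exact wedge_comp _ _ _
    rw [this]
    exact ((wedgeCLM E k l).contDiff.comp_contDiffOn (contDiffOn_rep α x₀)).clm_apply
      (contDiffOn_rep β x₀)⟩

lemma isOpen_target (x₀ : M) : IsOpen (extChartAt 𝓘(ℝ, E) x₀).target :=
  isOpen_extChartAt_target x₀

section
variable [IsManifold 𝓘(ℝ, E) ∞ M]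

lemma two_le_infty : minSmoothness ℝ 2 ≤ (∞ : WithTop ℕ∞) := by
  rw [minSmoothness_of_isRCLikeNormedField]
  exact WithTop.coe_le_coe.2 (le_top : (2 : ℕ∞) ≤ ⊤)

lemma comp_congr_point (α : ∀ x : M, TangentSpace 𝓘(ℝ, E) x [⋀^Fin k]→L[ℝ] ℝ) {p q : M}
    (h : p = q) (A B : E →L[ℝ] E) (hAB : A = B) :
    ((α p : E [⋀^Fin k]→L[ℝ] ℝ).compContinuousLinearMap A) =
      ((α q : E [⋀^Fin k]→L[ℝ] ℝ).compContinuousLinearMap B) := by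
  subst h; subst hAB; rfl

lemma mdifferentiableAt_chart_symm {x₀ : M} {y : E}
    (hy : y ∈ (extChartAt 𝓘(ℝ, E) x₀).target) :
    MDifferentiableAt 𝓘(ℝ, E) 𝓘(ℝ, E) (extChartAt 𝓘(ℝ, E) x₀).symm y := by
  have := IsManifold.of_le (I := 𝓘(ℝ, E)) (M := M) (m := 1) (n := ∞) (by simp)
  have h := mdifferentiableWithinAt_extChartAt_symm (I := 𝓘(ℝ, E)) hy
  simpa [mdifferentiableWithinAt_univ] using h

lemma mdifferentiableAt_chart {x₀ p : M} (hp : p ∈ (extChartAt 𝓘(ℝ, E) x₀).source) :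
    MDifferentiableAt 𝓘(ℝ, E) 𝓘(ℝ, E) (extChartAt 𝓘(ℝ, E) x₀) p := by
  have := IsManifold.of_le (I := 𝓘(ℝ, E)) (M := M) (m := 1) (n := ∞) (by simp)
  exact mdifferentiableAt_extChartAt (by simpa using hp)

lemma contDiffAt_transition {x₀ x₁ : M} {y : E} (hy : y ∈ (extChartAt 𝓘(ℝ, E) x₀).target)
    (hy' : (extChartAt 𝓘(ℝ, E) x₀).symm y ∈ (extChartAt 𝓘(ℝ, E) x₁).source) :
    ContDiffAt ℝ ∞ (extChartAt 𝓘(ℝ, E) x₁ ∘ (extChartAt 𝓘(ℝ, E) x₀).symm) y := by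
  have h := contDiffWithinAt_ext_coord_change (I := 𝓘(ℝ, E)) (n := ∞) x₁ x₀ (y := y)
    (by simp [PartialEquiv.trans_source] at hy hy' ⊢; exact ⟨hy, hy'⟩)
  simpa [contDiffWithinAt_univ] using h

lemma eventually_mem_overlap {x₀ x₁ : M} {y : E} (hy : y ∈ (extChartAt 𝓘(ℝ, E) x₀).target)
    (hy' : (extChartAt 𝓘(ℝ, E) x₀).symm y ∈ (extChartAt 𝓘(ℝ, E) x₁).source) :
    ∀ᶠ z in nhds y, z ∈ (extChartAt 𝓘(ℝ, E) x₀).target ∧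
      (extChartAt 𝓘(ℝ, E) x₀).symm z ∈ (extChartAt 𝓘(ℝ, E) x₁).source := by
  refine Filter.Eventually.and ((isOpen_target x₀).mem_nhds hy) ?_
  exact (continuousAt_extChartAt_symm'' hy).eventually
    ((isOpen_extChartAt_source (I := 𝓘(ℝ, E)) x₁).mem_nhds hy')

/-- Transition between two local representations: they are related by pull-back along the
change of coordinates. -/
lemma rep_change (α : ∀ x : M, TangentSpace 𝓘(ℝ, E) x [⋀^Fin k]→L[ℝ] ℝ) (x₀ x₁ : M) (y : E)
    (hy : y ∈ (extChartAt 𝓘(ℝ, E) x₀).target)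
    (hy' : (extChartAt 𝓘(ℝ, E) x₀).symm y ∈ (extChartAt 𝓘(ℝ, E) x₁).source) :
    rep α x₀ y = (rep α x₁ ((extChartAt 𝓘(ℝ, E) x₁ ∘
        (extChartAt 𝓘(ℝ, E) x₀).symm) y)).compContinuousLinearMap
      (fderiv ℝ (extChartAt 𝓘(ℝ, E) x₁ ∘ (extChartAt 𝓘(ℝ, E) x₀).symm) y) := by
  set τ := extChartAt 𝓘(ℝ, E) x₁ ∘ (extChartAt 𝓘(ℝ, E) x₀).symm with hτ
  have hev : (extChartAt 𝓘(ℝ, E) x₀).symm =ᶠ[nhds y] (extChartAt 𝓘(ℝ, E) x₁).symm ∘ τ := by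
    filter_upwards [eventually_mem_overlap hy hy'] with z hz
    simp only [hτ, Function.comp_apply]
    exact ((extChartAt 𝓘(ℝ, E) x₁).left_inv hz.2).symm
  have ht : τ y ∈ (extChartAt 𝓘(ℝ, E) x₁).target := (extChartAt 𝓘(ℝ, E) x₁).map_source hy'
  have hd : mfderiv 𝓘(ℝ, E) 𝓘(ℝ, E) (extChartAt 𝓘(ℝ, E) x₀).symm y =
      (mfderiv 𝓘(ℝ, E) 𝓘(ℝ, E) (extChartAt 𝓘(ℝ, E) x₁).symm (τ y)).comp
        (fderiv ℝ τ y) := by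
    have h1 := mfderiv_comp y (mdifferentiableAt_chart_symm ht)
      (((contDiffAt_transition hy hy').differentiableAt (by simp)).mdifferentiableAt)
    rw [mfderiv_eq_fderiv] at h1
    exact (Filter.EventuallyEq.mfderiv_eq hev).trans h1
  exact comp_congr_point α hev.eq_of_nhds _ _ hd

/-- The exterior derivative: at `x`, take the exterior derivative of the local representation in
the chart at `x` and pull it back along the chart. By `rep_extDSec` any other chart around `x` gives
the same result. -/
def extDSec (α : ∀ x : M, TangentSpace 𝓘(ℝ, E) x [⋀^Fin k]→L[ℝ] ℝ) (x : M) :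
    TangentSpace 𝓘(ℝ, E) x [⋀^Fin (k + 1)]→L[ℝ] ℝ :=
  (extDeriv (rep α x) (extChartAt 𝓘(ℝ, E) x x)).compContinuousLinearMap
    (mfderiv 𝓘(ℝ, E) 𝓘(ℝ, E) (extChartAt 𝓘(ℝ, E) x) x)

/-- The exterior derivative may be computed in any chart. -/
lemma rep_extDSec (α : Form E M k) (x₀ : M) (y : E)
    (hy : y ∈ (extChartAt 𝓘(ℝ, E) x₀).target) :
    rep (extDSec α.1) x₀ y = extDeriv (rep α.1 x₀) y := by
  set p := (extChartAt 𝓘(ℝ, E) x₀).symm y with hp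
  have hy' : (extChartAt 𝓘(ℝ, E) x₀).symm y ∈ (extChartAt 𝓘(ℝ, E) p).source :=
    mem_extChartAt_source (I := 𝓘(ℝ, E)) p
  set τ := extChartAt 𝓘(ℝ, E) p ∘ (extChartAt 𝓘(ℝ, E) x₀).symm with hτ
  have hτy : τ y = extChartAt 𝓘(ℝ, E) p p := rfl
  have hev : rep α.1 x₀ =ᶠ[nhds y] fun z =>
      (rep α.1 p (τ z)).compContinuousLinearMap (fderiv ℝ τ z) := by
    filter_upwards [eventually_mem_overlap hy hy'] with z hz
    exact rep_change α.1 x₀ p z hz.1 hz.2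
  have hdiff : DifferentiableAt ℝ (rep α.1 p) (τ y) :=
    ((contDiffOn_rep α p).contDiffAt ((isOpen_target p).mem_nhds
      (mem_extChartAt_target (I := 𝓘(ℝ, E)) p))).differentiableAt (by simp)
  rw [hev.extDeriv_eq, extDeriv_pullback hdiff (contDiffAt_transition hy hy') two_le_infty]
  have hd : (mfderiv 𝓘(ℝ, E) 𝓘(ℝ, E) (extChartAt 𝓘(ℝ, E) p) p).comp
      (mfderiv 𝓘(ℝ, E) 𝓘(ℝ, E) (extChartAt 𝓘(ℝ, E) x₀).symm y) = fderiv ℝ τ y := by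
    rw [← mfderiv_eq_fderiv]
    exact (mfderiv_comp y (mdifferentiableAt_chart hy') (mdifferentiableAt_chart_symm hy)).symm
  rw [← hd]
  rfl

end
end Forms

/-! ### The exterior derivative and the twisted differentials -/

section ExteriorDerivative

variable {E : Type*} [NormedAddCommGroup E] [NormedSpace ℝ E]
  {M : Type*} [TopologicalSpace M] [ChartedSpace E M] [IsManifold 𝓘(ℝ, E) ∞ M] {k l : ℕ}

lemma differentiableAt_rep (α : Form E M k) {x₀ : M} {y : E}
    (hy : y ∈ (extChartAt 𝓘(ℝ, E) x₀).target) : DifferentiableAt ℝ (rep α.1 x₀) y :=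
  ((contDiffOn_rep α x₀).contDiffAt ((isOpen_target x₀).mem_nhds hy)).differentiableAt (by simp)

lemma contDiffOn_fderiv_rep (α : Form E M k) (x₀ : M) :
    ContDiffOn ℝ ∞ (fderiv ℝ (rep α.1 x₀)) (extChartAt 𝓘(ℝ, E) x₀).target :=
  (contDiffOn_rep α x₀).fderiv_of_isOpen (isOpen_target x₀) (by simp)

/-- The exterior derivative `d : Ω^k(M) → Ω^{k+1}(M)`. -/
def extD : Form E M k →ₗ[ℝ] Form E M (k + 1) where
  toFun α := ⟨extDSec α.1, fun x₀ => by
    have h := (ContinuousAlternatingMap.alternatizeUncurryFinCLM ℝ E ℝ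
      (n := k)).contDiff.comp_contDiffOn (n := ∞) (contDiffOn_fderiv_rep α x₀)
    exact h.congr fun y hy => rep_extDSec α x₀ y hy⟩
  map_add' α β := by
    ext1
    funext x
    have h := extDeriv_add (differentiableAt_rep α (mem_extChartAt_target (I := 𝓘(ℝ, E)) x))
      (differentiableAt_rep β (mem_extChartAt_target (I := 𝓘(ℝ, E)) x))
    exact congrArg (fun η : E [⋀^Fin (k + 1)]→L[ℝ] ℝ => η.compContinuousLinearMap
      (mfderiv 𝓘(ℝ, E) 𝓘(ℝ, E) (extChartAt 𝓘(ℝ, E) x) x : E →L[ℝ] E)) h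
  map_smul' c α := by
    ext1
    funext x
    have h := extDeriv_smul (x := extChartAt 𝓘(ℝ, E) x x) c (rep α.1 x)
    exact congrArg (fun η : E [⋀^Fin (k + 1)]→L[ℝ] ℝ => η.compContinuousLinearMap
      (mfderiv 𝓘(ℝ, E) 𝓘(ℝ, E) (extChartAt 𝓘(ℝ, E) x) x : E →L[ℝ] E)) h

/-- Transport of a differential form along an equality of degrees (it does not change the form). -/
def Form.cast (h : k = l) (α : Form E M k) : Form E M l :=
  ⟨fun x => castForm h (α.1 x), by subst h; exact α.2⟩

/-- The twisted (Lichnerowicz) differential `d_c = d_{cθ} : Ω^k(M) → Ω^{k+1}(M)`,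
`d_c α = dα + c θ ∧ α`. -/
def lichD (θ : Form E M 1) (c : ℤ) : Form E M k →ₗ[ℝ] Form E M (k + 1) where
  toFun α := extD α + (c : ℝ) • (θ.wedge α).cast (Nat.add_comm 1 k)
  map_add' α β := by
    have : (θ.wedge (α + β)).cast (Nat.add_comm 1 k) =
        (θ.wedge α).cast (Nat.add_comm 1 k) + (θ.wedge β).cast (Nat.add_comm 1 k) := by
      ext x v
      change castForm _ (wedge (θ.1 x) (α.1 x + β.1 x)) v =
        castForm _ (wedge (θ.1 x) (α.1 x)) v + castForm _ (wedge (θ.1 x) (β.1 x)) v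
      rw [wedge_add_right]; simp only [castForm_apply]; rfl
    rw [map_add, this, smul_add]; abel
  map_smul' a α := by
    have : (θ.wedge (a • α)).cast (Nat.add_comm 1 k) =
        a • (θ.wedge α).cast (Nat.add_comm 1 k) := by
      ext x v
      change castForm _ (wedge (θ.1 x) (a • α.1 x)) v =
        a • castForm _ (wedge (θ.1 x) (α.1 x)) v
      rw [wedge_smul_right]; simp only [castForm_apply]; rfl
    rw [map_smul, this, RingHom.id_apply, smul_add, smul_comm]

/-- A `1`-form, seen as a linear functional. -/
def covec (θ : E [⋀^Fin 1]→L[ℝ] ℝ) : E →L[ℝ] ℝ :=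
  (ContinuousAlternatingMap.ofSubsingletonLIE (𝕜 := ℝ) (E := E) (F := ℝ) (0 : Fin 1)).symm θ

lemma covec_apply (θ : E [⋀^Fin 1]→L[ℝ] ℝ) (u : E) : covec θ u = θ (fun _ => u) := rfl

lemma rep_lichD (θ : Form E M 1) (c : ℤ) (α : Form E M k) (x₀ : M) (y : E)
    (hy : y ∈ (extChartAt 𝓘(ℝ, E) x₀).target) :
    rep (lichD θ c α).1 x₀ y = ContinuousAlternatingMap.alternatizeUncurryFinCLM ℝ E ℝ
      (fderiv ℝ (rep α.1 x₀) y + (c : ℝ) • (covec (rep θ.1 x₀ y)).smulRight (rep α.1 x₀ y)) := by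
  have h1 : rep (lichD θ c α).1 x₀ y = rep (extDSec α.1) x₀ y +
      (c : ℝ) • castForm (Nat.add_comm 1 k) (wedge (rep θ.1 x₀ y) (rep α.1 x₀ y)) := by
    have hw : castForm (Nat.add_comm 1 k) (wedge (rep θ.1 x₀ y) (rep α.1 x₀ y)) =
        ContinuousAlternatingMap.compContinuousLinearMap (M := E)
          (castForm (Nat.add_comm 1 k) (wedge (θ.1 ((extChartAt 𝓘(ℝ, E) x₀).symm y))
            (α.1 ((extChartAt 𝓘(ℝ, E) x₀).symm y))))
          (mfderiv 𝓘(ℝ, E) 𝓘(ℝ, E) (extChartAt 𝓘(ℝ, E) x₀).symm y) :=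
      (congrArg (castForm (V := E) (Nat.add_comm 1 k))
        (wedge_comp (V := E) (W := E) _ _ _).symm).trans (castForm_comp (V := E) (W := E) _ _ _)
    rw [hw]
    rfl
  rw [h1, rep_extDSec α x₀ y hy, map_add, map_smul]
  congr 2
  ext v
  rw [wedge_one]
  simp [ContinuousAlternatingMap.alternatizeUncurryFin_apply, covec_apply]

lemma form_eq_zero (β : Form E M k)
    (h : ∀ x₀ : M, ∀ y ∈ (extChartAt 𝓘(ℝ, E) x₀).target, rep β.1 x₀ y = 0) : β = 0 := by
  have := IsManifold.of_le (I := 𝓘(ℝ, E)) (M := M) (m := 1) (n := ∞) (by simp)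
  ext1
  funext x
  have h0 := h x _ (mem_extChartAt_target (I := 𝓘(ℝ, E)) x)
  have hid : mfderiv 𝓘(ℝ, E) 𝓘(ℝ, E) (extChartAt 𝓘(ℝ, E) x).symm (extChartAt 𝓘(ℝ, E) x x) =
      ContinuousLinearMap.id ℝ E := by
    have := mfderivWithin_range_extChartAt_symm (I := 𝓘(ℝ, E)) (x := x)
    rw [modelWithCornersSelf_coe, Set.range_id, mfderivWithin_univ] at this
    exact this
  have hc := comp_congr_point β.1 (extChartAt_to_inv (I := 𝓘(ℝ, E)) x) _ _ hid
  have h1 : (β.1 x : E [⋀^Fin k]→L[ℝ] ℝ).compContinuousLinearMap (ContinuousLinearMap.id ℝ E) = 0 :=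
    hc.symm.trans h0
  exact h1

lemma hasFDerivAt_smulRight {F : Type*} [NormedAddCommGroup F] [NormedSpace ℝ F]
    {t : E → E →L[ℝ] ℝ} {a : E → F} {t' : E →L[ℝ] E →L[ℝ] ℝ} {a' : E →L[ℝ] F} {y : E}
    (ht : HasFDerivAt t t' y) (ha : HasFDerivAt a a' y) :
    HasFDerivAt (fun z => (t z).smulRight (a z))
      ((ContinuousLinearMap.smulRightL ℝ E F).precompR E (t y) a' +
        (ContinuousLinearMap.smulRightL ℝ E F).precompL E t' (a y)) y :=
  (ContinuousLinearMap.smulRightL ℝ E F).hasFDerivAt_of_bilinear ht ha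

lemma local_twisted_sq {a : E → E [⋀^Fin k]→L[ℝ] ℝ} {t : E → E →L[ℝ] ℝ} {y : E}
    (ha : ContDiffAt ℝ ∞ a y) (ht : DifferentiableAt ℝ t y) (c : ℝ)
    (symt : ∀ u w : E, fderiv ℝ t y u w = fderiv ℝ t y w u) :
    ContinuousAlternatingMap.alternatizeUncurryFinCLM ℝ E ℝ
      (fderiv ℝ (fun z => ContinuousAlternatingMap.alternatizeUncurryFinCLM ℝ E ℝ
        (fderiv ℝ a z + c • (t z).smulRight (a z))) y +
        c • (t y).smulRight (ContinuousAlternatingMap.alternatizeUncurryFinCLM ℝ E ℝ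
          (fderiv ℝ a y + c • (t y).smulRight (a y)))) = 0 := by
  have da : DifferentiableAt ℝ a y := ha.differentiableAt (by simp)
  have dda : DifferentiableAt ℝ (fderiv ℝ a) y :=
    (ha.fderiv_right (m := ∞) (by simp)).differentiableAt (by simp)
  have syma : ∀ u w : E, fderiv ℝ (fderiv ℝ a) y u w = fderiv ℝ (fderiv ℝ a) y w u :=
    fun u w => (ha.isSymmSndFDerivAt two_le_infty) u w
  have hsm := hasFDerivAt_smulRight ht.hasFDerivAt da.hasFDerivAt
  have dF : HasFDerivAt (fun z => fderiv ℝ a z + c • (t z).smulRight (a z)) _ y :=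
    dda.hasFDerivAt.add (hsm.const_smul c)
  have dR := (ContinuousAlternatingMap.alternatizeUncurryFinCLM ℝ E ℝ (n := k)).hasFDerivAt.comp
    y dF
  have hR := dR.fderiv
  simp only [Function.comp_def] at hR
  rw [hR]
  set D := fderiv ℝ (fderiv ℝ a) y + c • ((ContinuousLinearMap.smulRightL ℝ E
    (E [⋀^Fin k]→L[ℝ] ℝ)).precompR E (t y) (fderiv ℝ a y) +
      (ContinuousLinearMap.smulRightL ℝ E
    (E [⋀^Fin k]→L[ℝ] ℝ)).precompL E (fderiv ℝ t y) (a y)) with hD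
  set F0 := fderiv ℝ a y + c • (t y).smulRight (a y) with hF0
  have hsym : ∀ u w, (D + c • (t y).smulRight F0) u w = (D + c • (t y).smulRight F0) w u := by
    intro u w
    have h1 : ∀ u w, (D + c • (t y).smulRight F0) u w = fderiv ℝ (fderiv ℝ a) y u w +
        c • (t y w • fderiv ℝ a y u + fderiv ℝ t y u w • a y) +
        c • (t y u • (fderiv ℝ a y w + c • t y w • a y)) := by
      intro u w
      rw [hD, hF0]
      rfl
    rw [h1, h1, syma u w, symt u w]
    module
  have key :=
    ContinuousAlternatingMap.alternatizeUncurryFin_alternatizeUncurryFinCLM_comp_of_symmetric hsym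
  rw [← key, ContinuousAlternatingMap.alternatizeUncurryFinCLM_apply]
  congr 1
  ext1 u
  simp only [_root_.add_apply, _root_.smul_apply,
    ContinuousLinearMap.comp_apply, ContinuousLinearMap.smulRight_apply, map_add, map_smul]

/-- If `θ` is closed then `d_c ∘ d_c = 0`. -/
lemma lichD_lichD (θ : Form E M 1) (hθ : extD θ = 0) (c : ℤ) (α : Form E M k) :
    lichD θ c (lichD θ c α) = 0 := by
  refine form_eq_zero _ fun x₀ y hy => ?_
  rw [rep_lichD _ _ _ _ _ hy]
  have hnhds := (isOpen_target x₀).mem_nhds hy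
  have hev : rep (lichD θ c α).1 x₀ =ᶠ[nhds y]
      fun z => ContinuousAlternatingMap.alternatizeUncurryFinCLM ℝ E ℝ
        (fderiv ℝ (rep α.1 x₀) z + (c : ℝ) • (covec (rep θ.1 x₀ z)).smulRight (rep α.1 x₀ z)) := by
    filter_upwards [hnhds] with z hz
    exact rep_lichD θ c α x₀ z hz
  have drt : DifferentiableAt ℝ (rep θ.1 x₀) y := differentiableAt_rep θ hy
  have dt : HasFDerivAt (fun z => covec (rep θ.1 x₀ z))
      (((ContinuousAlternatingMap.ofSubsingletonLIE (𝕜 := ℝ) (E := E) (F := ℝ) (0 : Fin 1)).symm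
      |>.toContinuousLinearEquiv.toContinuousLinearMap).comp (fderiv ℝ (rep θ.1 x₀) y)) y :=
    (((ContinuousAlternatingMap.ofSubsingletonLIE (𝕜 := ℝ) (E := E) (F := ℝ) (0 : Fin 1)).symm
      |>.toContinuousLinearEquiv.toContinuousLinearMap).hasFDerivAt).comp y drt.hasFDerivAt
  have symt : ∀ u w : E, fderiv ℝ (rep θ.1 x₀) y u (fun _ => w) =
      fderiv ℝ (rep θ.1 x₀) y w (fun _ => u) := by
    intro u w
    have h0 : extDeriv (rep θ.1 x₀) y = 0 := by
      rw [← rep_extDSec θ x₀ y hy]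
      have : extDSec θ.1 = 0 := congrArg Subtype.val hθ
      rw [this]; rfl
    have h1 := DFunLike.congr_fun h0 ![u, w]
    rw [extDeriv, ContinuousAlternatingMap.alternatizeUncurryFin_apply, Fin.sum_univ_two] at h1
    have e1 : Fin.removeNth 0 ![u, w] = fun _ => w := by ext i; fin_cases i; rfl
    have e2 : Fin.removeNth 1 ![u, w] = fun _ => u := by ext i; fin_cases i; rfl
    rw [e1, e2] at h1
    simp at h1
    linarith
  rw [hev.fderiv_eq, hev.eq_of_nhds]
  refine local_twisted_sq ((contDiffOn_rep α x₀).contDiffAt hnhds) dt.differentiableAt _ ?_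
  intro u w
  rw [dt.fderiv]
  exact symt u w

end ExteriorDerivative

/-! ### The Lefschetz operator and the Lefschetz filtration -/

section Lefschetz

variable {E : Type*} [NormedAddCommGroup E] [NormedSpace ℝ E]
  {M : Type*} [TopologicalSpace M] [ChartedSpace E M] [IsManifold 𝓘(ℝ, E) ∞ M] {k : ℕ}

variable (E M) in
/-- The constant function `1`, as a `0`-form. -/
def oneForm : Form E M 0 :=
  ⟨fun x => ContinuousAlternatingMap.constOfIsEmpty ℝ (TangentSpace 𝓘(ℝ, E) x) (Fin 0) (1 : ℝ),
    fun _ => contDiffOn_const (c := ContinuousAlternatingMap.constOfIsEmpty ℝ E (Fin 0) (1 : ℝ))⟩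

/-- The power `ω^T = ω ∧ ⋯ ∧ ω` (`T` factors) of a `2`-form, a form of degree `2T`. -/
def omegaPow (om : Form E M 2) : (T : ℕ) → Form E M (2 * T)
  | 0 => oneForm E M
  | T + 1 => (om.wedge (omegaPow om T)).cast (by omega)

/-- The Lefschetz operator `L : Ω^k(M) → Ω^{k+2}(M)`, `α ↦ ω ∧ α`. -/
def lefschetz (om : Form E M 2) : Form E M k →ₗ[ℝ] Form E M (k + 2) where
  toFun α := (om.wedge α).cast (Nat.add_comm 2 k)
  map_add' α β := by
    ext x v
    change castForm _ (wedge (om.1 x) (α.1 x + β.1 x)) v =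
      castForm _ (wedge (om.1 x) (α.1 x)) v + castForm _ (wedge (om.1 x) (β.1 x)) v
    rw [wedge_add_right]; simp only [castForm_apply]; rfl
  map_smul' a α := by
    ext x v
    change castForm _ (wedge (om.1 x) (a • α.1 x)) v =
      a • castForm _ (wedge (om.1 x) (α.1 x)) v
    rw [wedge_smul_right]; simp only [castForm_apply]; rfl

/-- The iterated Lefschetz operator `L^p : Ω^k(M) → Ω^{k+2p}(M)`. -/
def lefschetzPow (om : Form E M 2) : (p : ℕ) → Form E M k →ₗ[ℝ] Form E M (k + 2 * p)
  | 0 => LinearMap.id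
  | p + 1 => lefschetz om ∘ₗ lefschetzPow om p

/-- The degree `k` part `F^pK^k = L^p Ω^{k-2p}(M)` of the filtration `F^pK^* = L^pΩ^*(M)` of
`K^* = Ω^*(M)`; it is zero if `k < 2p`. -/
def lefschetzFiltration (om : Form E M 2) (p k : ℕ) : Submodule ℝ (Form E M k) where
  carrier := {α | ∃ (j : ℕ) (h : j + 2 * p = k) (β : Form E M j),
    α = (lefschetzPow om p β).cast h} ∪ {0}
  zero_mem' := Or.inr rfl
  add_mem' := by
    rintro _ _ (⟨j, rfl, β, rfl⟩ | rfl) (⟨j', h, β', rfl⟩ | rfl)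
    · obtain rfl : j' = j := by omega
      exact Or.inl ⟨j', rfl, β + β', by rw [map_add]; rfl⟩
    · exact Or.inl ⟨j, rfl, β, add_zero _⟩
    · exact Or.inl ⟨j', h, β', zero_add _⟩
    · exact Or.inr (add_zero _)
  smul_mem' := by
    rintro c _ (⟨j, rfl, β, rfl⟩ | rfl)
    · exact Or.inl ⟨j, rfl, c • β, by rw [map_smul]; rfl⟩
    · exact Or.inr (smul_zero _)

end Lefschetz

/-! ### The spectral sequence of a filtered complex -/

section SpectralSequence

/- `K` is a cochain complex in degrees `k ≥ 0` with differential `d`, and `F p k` is the degree `k`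
part `F^pK^k` of a decreasing filtration of `K` with `F^0K = K` (and so `F^pK = K` for `p < 0`).
Terms of the spectral sequence are indexed by the filtration degree `p` and the total degree `k`:
`Page d F r p k` is the term `E_r^{p,q}` with `p + q = k`. The terms with `p < 0` or `k < 0` vanish
and are left out. -/

variable {K : ℕ → Type*} [∀ k, AddCommGroup (K k)] [∀ k, Module ℝ (K k)]
  (d : ∀ k, K k →ₗ[ℝ] K (k + 1)) (F : ℕ → ∀ k, Submodule ℝ (K k))

/-- `Z_r^p = {x ∈ F^pK^k | dx ∈ F^{p+r}K^{k+1}}`. -/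
def cycles (r p k : ℕ) : Submodule ℝ (K k) :=
  F p k ⊓ (F (p + r) (k + 1)).comap (d k)

/-- `F^pK^k ∩ d(F^sK^{k-1})`, where `K^{-1} = 0`. -/
def boundaries (s p : ℕ) : (k : ℕ) → Submodule ℝ (K k)
  | 0 => ⊥
  | k + 1 => F p (k + 1) ⊓ (F s k).map (d k)

/-- `Z_{r-1}^{p+1} + B_{r-1}^p`, where `Z_{r-1}^{p+1} = {x ∈ F^{p+1}K^k | dx ∈ F^{p+r}K^{k+1}}` and
`B_{r-1}^p = F^pK^k ∩ d(F^{p+1-r}K^{k-1})`. For `r > p + 1` the index `p + 1 - r` is cut off at `0`,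
which is correct as `F^sK = K` for `s ≤ 0`. -/
def pageDenom (r p k : ℕ) : Submodule ℝ (K k) :=
  (F (p + 1) k ⊓ (F (p + r) (k + 1)).comap (d k)) ⊔ boundaries d F (p + 1 - r) p k

/-- The term `E_r^{p,k-p} = Z_r^p / (Z_{r-1}^{p+1} + B_{r-1}^p)` of the spectral sequence. -/
abbrev Page (r p k : ℕ) : Type _ :=
  cycles d F r p k ⧸ (pageDenom d F r p k).submoduleOf (cycles d F r p k)

/-- The differential `d_r : E_r^{p,q} → E_r^{p+r,q-r+1}`, `[x] ↦ [dx]` (it raises the total degree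
by one). -/
def pageD (hd : ∀ k x, d (k + 1) (d k x) = 0) (r p k : ℕ) :
    Page d F r p k →ₗ[ℝ] Page d F r (p + r) (k + 1) :=
  Submodule.mapQ _ _
    ((d k).restrict (p := cycles d F r p k) (q := cycles d F r (p + r) (k + 1))
      fun x hx => ⟨hx.2, by
        change d (k + 1) (d k x) ∈ F (p + r + r) (k + 1 + 1)
        rw [hd k x]
        exact Submodule.zero_mem _⟩)
    (by
      rintro ⟨x, hx⟩ hx'
      obtain ⟨y, hy, z, hz, rfl⟩ := Submodule.mem_sup.1 (show x ∈ pageDenom d F r p k from hx')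
      have hdz : d k z = 0 := by
        cases k with
        | zero => rw [(Submodule.mem_bot ℝ).1 hz, map_zero]
        | succ k =>
          obtain ⟨w, -, rfl⟩ := hz.2
          exact hd k w
      refine Submodule.mem_sup_right (show d k (y + z) ∈ boundaries d F _ _ _ from
        ⟨hx.2, y, ?_, by rw [map_add, hdz, add_zero]⟩)
      have : p + r + 1 - r = p + 1 := by omega
      rw [this]
      exact hy.1)

/-- The exact elements `dK^{k-1}` of `K^k`. -/
def exactElements : (k : ℕ) → Submodule ℝ (K k)
  | 0 => ⊥
  | k + 1 => LinearMap.range (d k)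

/-- The cohomology `H^k = ker(d : K^k → K^{k+1}) / d K^{k-1}`. -/
abbrev Cohomology (k : ℕ) : Type _ :=
  LinearMap.ker (d k) ⧸ (exactElements d k).submoduleOf (LinearMap.ker (d k))

/-- The induced filtration: `F^pH^k` is the set of classes of cocycles in `F^pK^k`. -/
def cohomologyFiltration (p k : ℕ) : Submodule ℝ (Cohomology d k) :=
  ((F p k).submoduleOf (LinearMap.ker (d k))).map (Submodule.mkQ _)

/-- `gr^p H^k = F^pH^k / F^{p+1}H^k`. -/
abbrev GrCohomology (p k : ℕ) : Type _ :=
  cohomologyFiltration d F p k ⧸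
    (cohomologyFiltration d F (p + 1) k).submoduleOf (cohomologyFiltration d F p k)

variable {d F} in
/-- The class in `E_r^p` of `z ∈ F^pK^k` with `dz = 0`. -/
def pageClass (r : ℕ) {p k : ℕ} (z : K k) (hz : z ∈ F p k) (hdz : d k z = 0) : Page d F r p k :=
  Submodule.Quotient.mk ⟨z, hz, by
    change d k z ∈ F (p + r) (k + 1)
    rw [hdz]
    exact Submodule.zero_mem _⟩

variable {d F} in
/-- The class in `gr^p H^k` of `z ∈ F^pK^k` with `dz = 0`. -/
def grClass {p k : ℕ} (z : K k) (hz : z ∈ F p k) (hdz : d k z = 0) : GrCohomology d F p k :=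
  Submodule.Quotient.mk ⟨Submodule.Quotient.mk ⟨z, hdz⟩,
    ⟨⟨z, hdz⟩, hz, rfl⟩⟩

/-- The spectral sequence stabilizes at the term `E_N`: all differentials `d_r` with `r ≥ N` vanish,
and `E_N = E_{N+1} = ⋯ = E_∞`, i.e. for all `r ≥ N` the term `E_r^{p,q}` is canonically
isomorphic to `F^pH^{p+q} / F^{p+1}H^{p+q}` (a cocycle in `F^pK^{p+q}` has corresponding classes on
both sides). -/
structure StabilizesAt (hd : ∀ k x, d (k + 1) (d k x) = 0) (N : ℕ) : Prop where
  differential_eq_zero : ∀ r, N ≤ r → ∀ p k, pageD d F hd r p k = 0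
  converges : ∀ r, N ≤ r → ∀ p k, ∃ e : Page d F r p k ≃ₗ[ℝ] GrCohomology d F p k,
    ∀ (z : K k) (hz : z ∈ F p k) (hdz : d k z = 0), e (pageClass r z hz hdz) = grClass z hz hdz

end SpectralSequence

/-! ### Locally conformal symplectic manifolds -/

section LCSManifold

/-- A locally conformal symplectic structure on the `2n`-dimensional manifold `M`: a non-degenerate
`2`-form `ω` and a closed `1`-form `θ` (the Lee form) with `dω = -ω ∧ θ`. -/
structure LCSManifold (n : ℕ) (M : Type*) [TopologicalSpace M]
    [ChartedSpace (EuclideanSpace ℝ (Fin (2 * n))) M] [IsManifold (𝓡 (2 * n)) ∞ M] where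
  /-- the `2`-form `ω` -/
  omega : Form (EuclideanSpace ℝ (Fin (2 * n))) M 2
  /-- the Lee form `θ` -/
  theta : Form (EuclideanSpace ℝ (Fin (2 * n))) M 1
  nondegenerate : ∀ (x : M) (u : TangentSpace (𝓡 (2 * n)) x),
    (∀ w : TangentSpace (𝓡 (2 * n)) x, omega.1 x ![u, w] = 0) → u = 0
  d_omega : extD omega = -(omega.wedge theta)
  d_theta : extD theta = 0

variable {n : ℕ} {M : Type*} [TopologicalSpace M]
  [ChartedSpace (EuclideanSpace ℝ (Fin (2 * n))) M] [IsManifold (𝓡 (2 * n)) ∞ M]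

/-- The differential `d_l α = dα + l θ ∧ α` of a locally conformal symplectic manifold. -/
def LCSManifold.d (X : LCSManifold n M) (l : ℤ) (k : ℕ) :
    Form (EuclideanSpace ℝ (Fin (2 * n))) M k →ₗ[ℝ]
      Form (EuclideanSpace ℝ (Fin (2 * n))) M (k + 1) :=
  lichD X.theta l

lemma LCSManifold.d_d (X : LCSManifold n M) (l : ℤ) (k : ℕ)
    (α : Form (EuclideanSpace ℝ (Fin (2 * n))) M k) : X.d l (k + 1) (X.d l k α) = 0 :=
  lichD_lichD X.theta X.d_theta l α

/-- The spectral sequence `(E_{l,r}^{p,q}, d_{l,r})` of the complex `(Ω^*(M), d_l)`, filtered by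
`F^p = L^pΩ^*(M)`, stabilizes at the term `E_{l,N}`. -/
def LCSManifold.SpectralSequenceStabilizesAt (X : LCSManifold n M) (l : ℤ) (N : ℕ) : Prop :=
  StabilizesAt (K := Form (EuclideanSpace ℝ (Fin (2 * n))) M) (X.d l)
    (lefschetzFiltration X.omega) (X.d_d l) N

end LCSManifold

end LCS

end

noncomputable section
namespace LCS

set_option linter.unusedSectionVars false

/-! ### Exterior algebra of one vector space: associativity and commutation with `1`-forms. -/

section WedgeAlgebra

variable {V : Type*} [AddCommGroup V] [Module ℝ V] [TopologicalSpace V] {k l m : ℕ}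

/-! The theorem follows from a strictness property of the filtration: if `d_l α` lies in `F^p`, then
`d_l α = d_l β` for some `β ∈ F^{p-T}`. Thus a differential can raise the filtration degree by more
than `T` only in ways that are already accounted for. A cycle of `E_r` with `r ≥ T + 1` can be
corrected by an element of `F^{p+1}` to a genuine cocycle, and an exact element of `F^p` has a
primitive as deep as the denominator of `E_r` asks. Hence `d_r = 0` and `E_r = gr H`
(`stabilizesAt_of_strict`).

For strictness (`exists_primitive_of_omegaPow_exact`), let `p = T + q` and `d_l α = L^p a` with `a`
of degree `j`. The equation `dω = -ω ∧ θ` says `d_1 ω = 0`, so `d_c L = L d_{c-1}` by the twisted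
Leibniz rule `lichD_wedge`.

If `j + 1 + p ≤ n`, then `L^p` is injective in degree `j + 1`, and `0 = d_l d_l α = L^p d_{l-p} a`
gives `d_{l-p} a = 0`. Then `β = L^q(ρ ∧ a)` works: `d_l β = L^q(d_T ρ ∧ a) = L^q(ω^T ∧ a) = L^p a`.

If `j + p ≥ n`, then `α` has degree `j + 2p - 1 ≥ n + q`. In such degrees every form lies in `F^q`,
because `L^s : Ω^{n-s} → Ω^{n+s}` is surjective for `0 ≤ s ≤ n`, and so `β = α` works.

Both Lefschetz facts reduce to linear algebra. Injectivity is proved by contracting with vectors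
(`lefPow_injective`), without `sl₂`-theory. Bijectivity in complementary degrees then follows by
comparing dimensions, and the inverse is smooth in charts because operator inversion is smooth. -/

lemma castForm_castForm (h : k = l) (h' : l = m) (α : V [⋀^Fin k]→L[ℝ] ℝ) :
    castForm h' (castForm h α) = castForm (h.trans h') α := by
  subst h; rfl

lemma castForm_add (h : k = l) (α β : V [⋀^Fin k]→L[ℝ] ℝ) :
    castForm h (α + β) = castForm h α + castForm h β := by
  subst h; rfl

lemma castForm_smul (h : k = l) (c : ℝ) (α : V [⋀^Fin k]→L[ℝ] ℝ) :
    castForm h (c • α) = c • castForm h α := by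
  subst h; rfl

lemma castForm_eq_zero {h : k = l} {α : V [⋀^Fin k]→L[ℝ] ℝ} :
    castForm h α = 0 ↔ α = 0 := by
  subst h; rfl

lemma wedge_castForm_left (h : k = l) (α : V [⋀^Fin k]→L[ℝ] ℝ) (β : V [⋀^Fin m]→L[ℝ] ℝ) :
    wedge (castForm h α) β = castForm (congrArg (· + m) h) (wedge α β) := by
  subst h; rfl

lemma wedge_castForm_right (h : k = l) (α : V [⋀^Fin m]→L[ℝ] ℝ) (β : V [⋀^Fin k]→L[ℝ] ℝ) :
    wedge α (castForm h β) = castForm (congrArg (m + ·) h) (wedge α β) := by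
  subst h; rfl

lemma wedge_zero_left (β : V [⋀^Fin l]→L[ℝ] ℝ) :
    wedge (0 : V [⋀^Fin k]→L[ℝ] ℝ) β = 0 := by
  simpa using wedge_smul_left 0 (0 : V [⋀^Fin k]→L[ℝ] ℝ) β

lemma wedge_zero_right (α : V [⋀^Fin k]→L[ℝ] ℝ) :
    wedge α (0 : V [⋀^Fin l]→L[ℝ] ℝ) = 0 := by
  simpa using wedge_smul_right 0 α (0 : V [⋀^Fin l]→L[ℝ] ℝ)

/-- A permutation of the first summand, extended by the identity. -/
def permLeft (n : ℕ) (τ : Equiv.Perm (Fin m)) : Equiv.Perm (Fin (m + n)) :=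
  finSumFinEquiv.permCongr (Equiv.Perm.sumCongr τ 1)

/-- A permutation of the second summand, extended by the identity. -/
def permRight (n : ℕ) (τ : Equiv.Perm (Fin m)) : Equiv.Perm (Fin (n + m)) :=
  finSumFinEquiv.permCongr (Equiv.Perm.sumCongr 1 τ)

lemma sign_permLeft (n : ℕ) (τ : Equiv.Perm (Fin m)) :
    Equiv.Perm.sign (permLeft n τ) = Equiv.Perm.sign τ := by
  simp [permLeft, Equiv.Perm.sign_permCongr, Equiv.Perm.sign_sumCongr]

lemma sign_permRight (n : ℕ) (τ : Equiv.Perm (Fin m)) :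
    Equiv.Perm.sign (permRight n τ) = Equiv.Perm.sign τ := by
  simp [permRight, Equiv.Perm.sign_permCongr, Equiv.Perm.sign_sumCongr]

@[simp] lemma permLeft_castAdd (n : ℕ) (τ : Equiv.Perm (Fin m)) (i : Fin m) :
    permLeft n τ (Fin.castAdd n i) = Fin.castAdd n (τ i) := by
  simp [permLeft, Equiv.permCongr_apply]

@[simp] lemma permLeft_natAdd (n : ℕ) (τ : Equiv.Perm (Fin m)) (i : Fin n) :
    permLeft n τ (Fin.natAdd m i) = Fin.natAdd m i := by
  simp [permLeft, Equiv.permCongr_apply]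

@[simp] lemma permRight_castAdd (n : ℕ) (τ : Equiv.Perm (Fin m)) (i : Fin n) :
    permRight n τ (Fin.castAdd m i) = Fin.castAdd m i := by
  simp [permRight, Equiv.permCongr_apply]

@[simp] lemma permRight_natAdd (n : ℕ) (τ : Equiv.Perm (Fin m)) (i : Fin m) :
    permRight n τ (Fin.natAdd n i) = Fin.natAdd n (τ i) := by
  simp [permRight, Equiv.permCongr_apply]

/-- The substitution `σ ↦ σ τ` in a signed sum. It makes a repeated antisymmetrization redundant,
and it also moves a `1`-form past a `k`-form. -/
lemma sum_sign_mul_right {N : ℕ} (G : Equiv.Perm (Fin N) → ℝ) (τ : Equiv.Perm (Fin N)) :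
    ∑ σ : Equiv.Perm (Fin N), ((Equiv.Perm.sign σ : ℤ) : ℝ) * G (σ * τ) =
      ((Equiv.Perm.sign τ : ℤ) : ℝ) *
        ∑ σ : Equiv.Perm (Fin N), ((Equiv.Perm.sign σ : ℤ) : ℝ) * G σ := by
  rw [← Equiv.sum_comp (Equiv.mulRight τ) (fun σ => ((Equiv.Perm.sign σ : ℤ) : ℝ) * G σ),
    Finset.mul_sum]
  refine Finset.sum_congr rfl fun σ _ => ?_
  have h4 : ((Equiv.Perm.sign τ : ℤ) : ℝ) * ((Equiv.Perm.sign τ : ℤ) : ℝ) = 1 := by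
    rw [← Int.cast_mul]; simp [← Units.val_mul]
  simp only [Equiv.coe_mulRight, Equiv.Perm.sign_mul, Units.val_mul, Int.cast_mul]
  linear_combination (-((Equiv.Perm.sign σ : ℤ) : ℝ) * G (σ * τ)) * h4

lemma sign_mul_sign {N : ℕ} (τ : Equiv.Perm (Fin N)) :
    ((Equiv.Perm.sign τ : ℤ) : ℝ) * ((Equiv.Perm.sign τ : ℤ) : ℝ) = 1 := by
  rw [← Int.cast_mul]; simp [← Units.val_mul]

/-- The inner antisymmetrization over `S_{k+l}` is absorbed by the outer one over `S_{k+l+m}`. The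
result is symmetric in the bracketing, so associativity comes down to matching two such sums. -/
lemma wedge_wedge_left_apply (α : V [⋀^Fin k]→L[ℝ] ℝ) (β : V [⋀^Fin l]→L[ℝ] ℝ)
    (γ : V [⋀^Fin m]→L[ℝ] ℝ) (v : Fin (k + l + m) → V) :
    wedge (wedge α β) γ v = ((k ! * l ! * m ! : ℝ)⁻¹) * ∑ σ : Equiv.Perm (Fin (k + l + m)),
      ((Equiv.Perm.sign σ : ℤ) : ℝ) * (α (fun i => v (σ (Fin.castAdd m (Fin.castAdd l i)))) *
        β (fun j => v (σ (Fin.castAdd m (Fin.natAdd k j)))) *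
        γ (fun j => v (σ (Fin.natAdd (k + l) j)))) := by
  set G : Equiv.Perm (Fin (k + l + m)) → ℝ := fun σ =>
    α (fun i => v (σ (Fin.castAdd m (Fin.castAdd l i)))) *
        β (fun j => v (σ (Fin.castAdd m (Fin.natAdd k j)))) *
        γ (fun j => v (σ (Fin.natAdd (k + l) j))) with hG
  have key : ∀ σ : Equiv.Perm (Fin (k + l + m)),
      wedge α β (fun i => v (σ (Fin.castAdd m i))) * γ (fun j => v (σ (Fin.natAdd (k + l) j))) =
      (k ! * l ! : ℝ)⁻¹ * ∑ τ : Equiv.Perm (Fin (k + l)), ((Equiv.Perm.sign τ : ℤ) : ℝ) *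
        G (σ * permLeft m τ) := by
    intro σ
    rw [wedge_apply, mul_assoc, Finset.sum_mul]
    simp only [hG, Equiv.Perm.mul_apply, permLeft_castAdd, permLeft_natAdd]
    congr 1
    refine Finset.sum_congr rfl fun τ _ => ?_
    ring
  rw [wedge_apply]
  simp only [key]
  -- After the substitution `σ ↦ σ τ` every `τ` contributes the same amount, so the sum over `τ`
  -- produces a factor `(k + l)!` that cancels the normalization of the outer product.
  have h2 : ∑ σ : Equiv.Perm (Fin (k + l + m)), ((Equiv.Perm.sign σ : ℤ) : ℝ) *
      ((k ! * l ! : ℝ)⁻¹ * ∑ τ : Equiv.Perm (Fin (k + l)), ((Equiv.Perm.sign τ : ℤ) : ℝ) *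
        G (σ * permLeft m τ)) = (k ! * l ! : ℝ)⁻¹ * (((k + l)! : ℝ) *
        ∑ σ : Equiv.Perm (Fin (k + l + m)), ((Equiv.Perm.sign σ : ℤ) : ℝ) * G σ) := by
    have : ∀ τ : Equiv.Perm (Fin (k + l)), ∑ σ : Equiv.Perm (Fin (k + l + m)),
        ((Equiv.Perm.sign τ : ℤ) : ℝ) * (((Equiv.Perm.sign σ : ℤ) : ℝ) * G (σ * permLeft m τ)) =
        ∑ σ : Equiv.Perm (Fin (k + l + m)), ((Equiv.Perm.sign σ : ℤ) : ℝ) * G σ := by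
      intro τ
      rw [← Finset.mul_sum, sum_sign_mul_right G, sign_permLeft, ← mul_assoc, sign_mul_sign,
        one_mul]
    have h3 : ((k + l)! : ℝ) *
        ∑ σ : Equiv.Perm (Fin (k + l + m)), ((Equiv.Perm.sign σ : ℤ) : ℝ) * G σ =
        ∑ τ : Equiv.Perm (Fin (k + l)), ∑ σ : Equiv.Perm (Fin (k + l + m)),
        ((Equiv.Perm.sign τ : ℤ) : ℝ) * (((Equiv.Perm.sign σ : ℤ) : ℝ) * G (σ * permLeft m τ)) := by
      simp only [this]
      simp [Fintype.card_perm]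
    rw [h3, Finset.sum_comm, Finset.mul_sum]
    refine Finset.sum_congr rfl fun σ _ => ?_
    simp only [Finset.mul_sum]
    refine Finset.sum_congr rfl fun τ _ => ?_
    ring
  have h0 : ((k + l)! : ℝ) ≠ 0 := by positivity
  rw [h2]
  change _ = _ * ∑ σ, _ * G σ
  generalize ∑ σ : Equiv.Perm (Fin (k + l + m)), ((Equiv.Perm.sign σ : ℤ) : ℝ) * G σ = S
  field_simp

lemma wedge_wedge_right_apply (α : V [⋀^Fin k]→L[ℝ] ℝ) (β : V [⋀^Fin l]→L[ℝ] ℝ)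
    (γ : V [⋀^Fin m]→L[ℝ] ℝ) (v : Fin (k + (l + m)) → V) :
    wedge α (wedge β γ) v = ((k ! * l ! * m ! : ℝ)⁻¹) * ∑ σ : Equiv.Perm (Fin (k + (l + m))),
      ((Equiv.Perm.sign σ : ℤ) : ℝ) * (α (fun i => v (σ (Fin.castAdd (l + m) i))) *
        β (fun j => v (σ (Fin.natAdd k (Fin.castAdd m j)))) *
        γ (fun j => v (σ (Fin.natAdd k (Fin.natAdd l j))))) := by
  set G : Equiv.Perm (Fin (k + (l + m))) → ℝ := fun σ =>
    α (fun i => v (σ (Fin.castAdd (l + m) i))) *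
        β (fun j => v (σ (Fin.natAdd k (Fin.castAdd m j)))) *
        γ (fun j => v (σ (Fin.natAdd k (Fin.natAdd l j)))) with hG
  have key : ∀ σ : Equiv.Perm (Fin (k + (l + m))),
      α (fun i => v (σ (Fin.castAdd (l + m) i))) * wedge β γ (fun j => v (σ (Fin.natAdd k j))) =
      (l ! * m ! : ℝ)⁻¹ * ∑ τ : Equiv.Perm (Fin (l + m)), ((Equiv.Perm.sign τ : ℤ) : ℝ) *
        G (σ * permRight k τ) := by
    intro σ
    rw [wedge_apply, mul_left_comm, Finset.mul_sum]
    simp only [hG, Equiv.Perm.mul_apply, permRight_castAdd, permRight_natAdd]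
    congr 1
    refine Finset.sum_congr rfl fun τ _ => ?_
    ring
  rw [wedge_apply]
  simp only [key]
  have h2 : ∑ σ : Equiv.Perm (Fin (k + (l + m))), ((Equiv.Perm.sign σ : ℤ) : ℝ) *
      ((l ! * m ! : ℝ)⁻¹ * ∑ τ : Equiv.Perm (Fin (l + m)), ((Equiv.Perm.sign τ : ℤ) : ℝ) *
        G (σ * permRight k τ)) = (l ! * m ! : ℝ)⁻¹ * (((l + m)! : ℝ) *
        ∑ σ : Equiv.Perm (Fin (k + (l + m))), ((Equiv.Perm.sign σ : ℤ) : ℝ) * G σ) := by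
    have : ∀ τ : Equiv.Perm (Fin (l + m)), ∑ σ : Equiv.Perm (Fin (k + (l + m))),
        ((Equiv.Perm.sign τ : ℤ) : ℝ) * (((Equiv.Perm.sign σ : ℤ) : ℝ) * G (σ * permRight k τ)) =
        ∑ σ : Equiv.Perm (Fin (k + (l + m))), ((Equiv.Perm.sign σ : ℤ) : ℝ) * G σ := by
      intro τ
      rw [← Finset.mul_sum, sum_sign_mul_right G, sign_permRight, ← mul_assoc, sign_mul_sign,
        one_mul]
    have h3 : ((l + m)! : ℝ) *
        ∑ σ : Equiv.Perm (Fin (k + (l + m))), ((Equiv.Perm.sign σ : ℤ) : ℝ) * G σ =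
        ∑ τ : Equiv.Perm (Fin (l + m)), ∑ σ : Equiv.Perm (Fin (k + (l + m))),
        ((Equiv.Perm.sign τ : ℤ) : ℝ) *
          (((Equiv.Perm.sign σ : ℤ) : ℝ) * G (σ * permRight k τ)) := by
      simp only [this]
      simp [Fintype.card_perm]
    rw [h3, Finset.sum_comm, Finset.mul_sum]
    refine Finset.sum_congr rfl fun σ _ => ?_
    simp only [Finset.mul_sum]
    refine Finset.sum_congr rfl fun τ _ => ?_
    ring
  have h0 : ((l + m)! : ℝ) ≠ 0 := by positivity
  rw [h2]
  change _ = _ * ∑ σ, _ * G σ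
  generalize ∑ σ : Equiv.Perm (Fin (k + (l + m))), ((Equiv.Perm.sign σ : ℤ) : ℝ) * G σ = S
  field_simp

/-- The exterior product is associative. -/
lemma wedge_assoc (α : V [⋀^Fin k]→L[ℝ] ℝ) (β : V [⋀^Fin l]→L[ℝ] ℝ) (γ : V [⋀^Fin m]→L[ℝ] ℝ) :
    castForm (Nat.add_assoc k l m) (wedge (wedge α β) γ) = wedge α (wedge β γ) := by
  ext v
  rw [castForm_apply, wedge_wedge_left_apply, wedge_wedge_right_apply,
    ← Equiv.sum_comp (Equiv.permCongr (finCongr (Nat.add_assoc k l m).symm))]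
  congr 1
  refine Finset.sum_congr rfl fun σ _ => ?_
  rw [Equiv.Perm.sign_permCongr]
  congr 2
  · congr 2
    ext i
    simp only [Equiv.permCongr_apply, finCongr_symm, finCongr_apply, Fin.cast_cast, Fin.cast_eq_self]
    congr 2
    ext
    simp [Nat.add_assoc]

/-- The exterior product `θ ∧ α` of a `1`-form and a `k`-form, in degree `k + 1`. -/
def wedgeOne (θ : V [⋀^Fin 1]→L[ℝ] ℝ) (α : V [⋀^Fin k]→L[ℝ] ℝ) : V [⋀^Fin (k + 1)]→L[ℝ] ℝ :=
  castForm (Nat.add_comm 1 k) (wedge θ α)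

lemma wedgeOne_apply (θ : V [⋀^Fin 1]→L[ℝ] ℝ) (α : V [⋀^Fin k]→L[ℝ] ℝ) (v : Fin (k + 1) → V) :
    wedgeOne θ α v = ∑ i : Fin (k + 1), (-1) ^ (i : ℕ) * (θ (fun _ => v i) * α (i.removeNth v)) :=
  wedge_one θ α v

lemma wedgeOne_add_right (θ : V [⋀^Fin 1]→L[ℝ] ℝ) (α β : V [⋀^Fin k]→L[ℝ] ℝ) :
    wedgeOne θ (α + β) = wedgeOne θ α + wedgeOne θ β := by
  simp only [wedgeOne, wedge_add_right, castForm_add]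

lemma wedgeOne_smul_right (θ : V [⋀^Fin 1]→L[ℝ] ℝ) (c : ℝ) (α : V [⋀^Fin k]→L[ℝ] ℝ) :
    wedgeOne θ (c • α) = c • wedgeOne θ α := by
  simp only [wedgeOne, wedge_smul_right, castForm_smul]

lemma wedge_eq_wedgeOne (α : V [⋀^Fin k]→L[ℝ] ℝ) (θ : V [⋀^Fin 1]→L[ℝ] ℝ) :
    wedge α θ = (-1 : ℝ) ^ k • wedgeOne θ α := by
  ext v
  have hk : (k ! : ℝ) ≠ 0 := by positivity
  have key := sum_perm_succ k (fun x => θ (fun _ => x)) α v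
  -- The inverse rotation moves the argument of `θ` from the first place to the last; its sign is
  -- `(-1)^k`.
  have hs := sum_sign_mul_right (fun σ : Equiv.Perm (Fin (k + 1)) =>
    θ (fun _ => v (σ 0)) * α (fun j => v (σ j.succ))) (finRotate (k + 1))⁻¹
  have e0 : (finRotate (k + 1))⁻¹ 0 = Fin.last k := by
    rw [Equiv.Perm.inv_eq_iff_eq, finRotate_last]
  have e1 : ∀ j : Fin k, (finRotate (k + 1))⁻¹ j.succ = j.castSucc := by
    intro j
    rw [Equiv.Perm.inv_eq_iff_eq, finRotate_apply, Fin.coeSucc_eq_succ]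
  rw [key, Equiv.Perm.sign_inv, sign_finRotate] at hs
  simp only [Equiv.Perm.mul_apply, e0, e1] at hs
  have hc : ((-1 : ℝ) ^ k) = (((-1 : ℤˣ) ^ (k + 1 - 1) : ℤˣ) : ℤ) := by simp
  rw [ContinuousAlternatingMap.smul_apply, wedgeOne_apply, smul_eq_mul, wedge_apply, Nat.factorial_one,
    Nat.cast_one, mul_one, inv_mul_eq_iff_eq_mul₀ hk, mul_left_comm, hc, ← hs]
  refine Finset.sum_congr rfl fun σ _ => ?_
  rw [mul_comm (α _)]
  congr 3
  ext i
  fin_cases i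
  rfl

lemma castForm_wedgeOne_wedge (θ : V [⋀^Fin 1]→L[ℝ] ℝ) (α : V [⋀^Fin k]→L[ℝ] ℝ)
    (β : V [⋀^Fin l]→L[ℝ] ℝ) :
    castForm (Nat.add_right_comm k 1 l) (wedge (wedgeOne θ α) β) = wedgeOne θ (wedge α β) := by
  rw [wedgeOne, wedgeOne, ← wedge_assoc, wedge_castForm_left, castForm_castForm, castForm_castForm]

lemma wedge_wedgeOne (α : V [⋀^Fin k]→L[ℝ] ℝ) (θ : V [⋀^Fin 1]→L[ℝ] ℝ)
    (β : V [⋀^Fin l]→L[ℝ] ℝ) :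
    wedge α (wedgeOne θ β) = (-1 : ℝ) ^ k • wedgeOne θ (wedge α β) := by
  rw [wedgeOne, wedge_castForm_right, ← wedge_assoc, wedge_eq_wedgeOne, wedge_smul_left,
    ← castForm_wedgeOne_wedge, castForm_castForm, castForm_smul]

/-- The Lefschetz operator `α ↦ ω ∧ α` on alternating forms. -/
def lef (om : V [⋀^Fin 2]→L[ℝ] ℝ) (α : V [⋀^Fin k]→L[ℝ] ℝ) : V [⋀^Fin (k + 2)]→L[ℝ] ℝ :=
  castForm (Nat.add_comm 2 k) (wedge om α)

lemma lef_add (om : V [⋀^Fin 2]→L[ℝ] ℝ) (α β : V [⋀^Fin k]→L[ℝ] ℝ) :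
    lef om (α + β) = lef om α + lef om β := by
  simp only [lef, wedge_add_right, castForm_add]

lemma lef_smul (om : V [⋀^Fin 2]→L[ℝ] ℝ) (c : ℝ) (α : V [⋀^Fin k]→L[ℝ] ℝ) :
    lef om (c • α) = c • lef om α := by
  simp only [lef, wedge_smul_right, castForm_smul]

lemma lef_zero (om : V [⋀^Fin 2]→L[ℝ] ℝ) : lef om (0 : V [⋀^Fin k]→L[ℝ] ℝ) = 0 := by
  rw [lef, wedge_zero_right, castForm_eq_zero]

lemma lef_castForm (om : V [⋀^Fin 2]→L[ℝ] ℝ) (h : k = l) (α : V [⋀^Fin k]→L[ℝ] ℝ) :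
    lef om (castForm h α) = castForm (congrArg (· + 2) h) (lef om α) := by
  subst h; rfl

lemma castForm_lef_wedge (om : V [⋀^Fin 2]→L[ℝ] ℝ) (α : V [⋀^Fin k]→L[ℝ] ℝ)
    (β : V [⋀^Fin l]→L[ℝ] ℝ) :
    castForm (Nat.add_right_comm k 2 l) (wedge (lef om α) β) = lef om (wedge α β) := by
  rw [lef, lef, ← wedge_assoc, wedge_castForm_left, castForm_castForm, castForm_castForm]

/-- A `2`-form has even degree, so the sign in `wedge_wedgeOne` is `(-1)^2 = 1`. -/
lemma lef_wedgeOne (om : V [⋀^Fin 2]→L[ℝ] ℝ) (θ : V [⋀^Fin 1]→L[ℝ] ℝ)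
    (α : V [⋀^Fin k]→L[ℝ] ℝ) : lef om (wedgeOne θ α) = wedgeOne θ (lef om α) := by
  have h := wedge_wedgeOne om θ α
  have h2 : castForm (Nat.add_comm 2 (k + 1)) (wedge om (wedgeOne θ α)) =
    castForm (k := 2 + k + 1) (Nat.add_comm 2 (k + 1)) (wedgeOne θ (wedge om α)) := by
    rw [h]; simp
  refine h2.trans ?_
  rw [wedgeOne, castForm_castForm, wedgeOne, lef, wedge_castForm_right, castForm_castForm]

lemma wedge_constOfIsEmpty (α : V [⋀^Fin k]→L[ℝ] ℝ) :
    castForm (Nat.zero_add k)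
      (wedge (ContinuousAlternatingMap.constOfIsEmpty ℝ V (Fin 0) (1 : ℝ)) α) = α := by
  ext v
  rw [castForm_apply, wedge_apply, ← Equiv.sum_comp (Equiv.permCongr (finCongr (Nat.zero_add k).symm))]
  have hk : (k ! : ℝ) ≠ 0 := by positivity
  have : ∀ σ : Equiv.Perm (Fin k),
      ((Equiv.Perm.sign σ : ℤ) : ℝ) * α (fun j => v (σ j)) = α v := by
    intro σ
    have h := α.toAlternatingMap.map_perm v σ
    have h' : α (fun j => v (σ j)) = ((Equiv.Perm.sign σ : ℤ) : ℝ) * α v := by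
      simpa [Units.smul_def, Function.comp_def] using h
    rw [h', ← mul_assoc, sign_mul_sign, one_mul]
  rw [Finset.sum_congr rfl (g := fun _ => α v)]
  · simp [Fintype.card_perm, hk]
  · intro σ _
    rw [← this σ, Equiv.Perm.sign_permCongr]
    simp [Equiv.permCongr_apply]

end WedgeAlgebra

/-! ### Contraction and the Lefschetz operator on a finite-dimensional vector space. -/

section PointwiseLefschetz

variable {E F : Type*} [NormedAddCommGroup E] [NormedSpace ℝ E]
  [NormedAddCommGroup F] [NormedSpace ℝ F] {k l : ℕ}

/-- The `p`-fold iterate of the Lefschetz operator on alternating forms. -/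
def lefPow (om : E [⋀^Fin 2]→L[ℝ] ℝ) : (p : ℕ) → E [⋀^Fin k]→L[ℝ] ℝ → E [⋀^Fin (k + 2 * p)]→L[ℝ] ℝ
  | 0, α => α
  | p + 1, α => lef om (lefPow om p α)

variable (om : E [⋀^Fin 2]→L[ℝ] ℝ)

lemma lefPow_succ (p : ℕ) (α : E [⋀^Fin k]→L[ℝ] ℝ) :
    lefPow om (p + 1) α = lef om (lefPow om p α) := rfl

lemma castForm_comm {h : k = l} (α : E [⋀^Fin k]→L[ℝ] ℝ) (β : E [⋀^Fin l]→L[ℝ] ℝ) :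
    castForm h α = β ↔ α = castForm h.symm β := by
  subst h; rfl

lemma lef_comp (α : E [⋀^Fin k]→L[ℝ] ℝ) (f : F →L[ℝ] E) :
    (lef om α).compContinuousLinearMap f =
      lef (om.compContinuousLinearMap f) (α.compContinuousLinearMap f) := by
  rw [lef, lef, ← wedge_comp, castForm_comp]

lemma lefPow_comp (p : ℕ) (α : E [⋀^Fin k]→L[ℝ] ℝ) (f : F →L[ℝ] E) :
    (lefPow om p α).compContinuousLinearMap f =
      lefPow (om.compContinuousLinearMap f) p (α.compContinuousLinearMap f) := by
  induction p with
  | zero => rfl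
  | succ p ih => rw [lefPow_succ, lefPow_succ, ← ih, ← lef_comp]

/-- Here `curryLeft v` is the interior product `ι_v`. The term `i = 0` of the alternating sum gives
`θ(v) α`; the others are shifted by one place, whence the minus sign. This is the only case of the
antiderivation rule proved directly. -/
lemma curryLeft_wedgeOne (θ : E [⋀^Fin 1]→L[ℝ] ℝ) (α : E [⋀^Fin (k + 1)]→L[ℝ] ℝ) (v : E) :
    (wedgeOne θ α).curryLeft v = θ (fun _ => v) • α - wedgeOne θ (α.curryLeft v) := by
  ext w
  rw [ContinuousAlternatingMap.curryLeft_apply_apply, wedgeOne_apply, Fin.sum_univ_succ,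
    ContinuousAlternatingMap.sub_apply, wedgeOne_apply, ContinuousAlternatingMap.smul_apply,
    sub_eq_add_neg, ← Finset.sum_neg_distrib]
  congr 1
  · simp
  · refine Finset.sum_congr rfl fun i _ => ?_
    have : Fin.removeNth i.succ (Matrix.vecCons v w) = Matrix.vecCons v (i.removeNth w) := by
      ext j
      refine Fin.cases ?_ (fun j => ?_) j
      · simp [Fin.removeNth]
      · simp [Fin.removeNth]
    rw [this]
    simp [pow_succ]

lemma curryLeft_wedgeOne_zero (θ : E [⋀^Fin 1]→L[ℝ] ℝ) (α : E [⋀^Fin 0]→L[ℝ] ℝ) (v : E) :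
    (wedgeOne θ α).curryLeft v = θ (fun _ => v) • α := by
  ext w
  rw [ContinuousAlternatingMap.curryLeft_apply_apply, wedgeOne_apply, Fin.sum_univ_succ,
    ContinuousAlternatingMap.smul_apply]
  simp [Subsingleton.elim _ w]

variable {ι : Type*} [Fintype ι] [FiniteDimensional ℝ E]

/-- The coordinate functional of a basis, as an alternating `1`-form. -/
def coordForm (c : Module.Basis ι ℝ E) (i : ι) : E [⋀^Fin 1]→L[ℝ] ℝ :=
  ContinuousAlternatingMap.ofSubsingletonLIE (𝕜 := ℝ) (E := E) (F := ℝ) (0 : Fin 1)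
    (LinearMap.toContinuousLinearMap (c.coord i))

lemma coordForm_apply (c : Module.Basis ι ℝ E) (i : ι) (v : Fin 1 → E) :
    coordForm c i v = c.repr (v 0) i := rfl

/-- By linearity of `G`, expand in the basis the vector fed to it. Applied to a Fréchet derivative
this reads `d = ∑ eⁱ ∧ ∂ᵢ`. -/
lemma alternatizeUncurryFin_eq_sum (c : Module.Basis ι ℝ E) (G : E →L[ℝ] E [⋀^Fin k]→L[ℝ] ℝ) :
    ContinuousAlternatingMap.alternatizeUncurryFin G = ∑ i, wedgeOne (coordForm c i) (G (c i)) := by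
  ext v
  simp only [ContinuousAlternatingMap.alternatizeUncurryFin_apply,
    ContinuousAlternatingMap.sum_apply, wedgeOne_apply, coordForm_apply]
  rw [Finset.sum_comm]
  refine Finset.sum_congr rfl fun j _ => ?_
  rw [← Finset.mul_sum]
  have h := congrArg (fun u => G u (j.removeNth v)) (c.sum_repr (v j))
  simp only [map_sum, map_smul, ContinuousAlternatingMap.sum_apply,
    ContinuousAlternatingMap.smul_apply, smul_eq_mul] at h
  rw [h]
  simp

/-- Euler's identity `∑ eⁱ ∧ ι_{eᵢ} α = (deg α) α`. It both decomposes `ω` into products of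
`1`-forms and supplies the degree count in `lefPow_eq_zero_of_succ`. -/
lemma sum_wedgeOne_curryLeft (c : Module.Basis ι ℝ E) (α : E [⋀^Fin (k + 1)]→L[ℝ] ℝ) :
    ∑ i, wedgeOne (coordForm c i) (α.curryLeft (c i)) = ((k + 1 : ℕ) : ℝ) • α := by
  rw [← alternatizeUncurryFin_eq_sum, ContinuousAlternatingMap.alternatizeUncurryFin_curryLeft,
    Nat.cast_smul_eq_nsmul]

lemma wedgeOne_smul_left (c : ℝ) (θ : E [⋀^Fin 1]→L[ℝ] ℝ) (α : E [⋀^Fin k]→L[ℝ] ℝ) :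
    wedgeOne (c • θ) α = c • wedgeOne θ α := by
  simp only [wedgeOne, wedge_smul_left, castForm_smul]

lemma wedgeOne_add_left (θ θ' : E [⋀^Fin 1]→L[ℝ] ℝ) (α : E [⋀^Fin k]→L[ℝ] ℝ) :
    wedgeOne (θ + θ') α = wedgeOne θ α + wedgeOne θ' α := by
  simp only [wedgeOne, wedge_add_left, castForm_add]

lemma wedgeOne_sub_right (θ : E [⋀^Fin 1]→L[ℝ] ℝ) (α β : E [⋀^Fin k]→L[ℝ] ℝ) :
    wedgeOne θ (α - β) = wedgeOne θ α - wedgeOne θ β := by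
  rw [eq_sub_iff_add_eq, ← wedgeOne_add_right, sub_add_cancel]

lemma wedgeOne_neg_left (θ : E [⋀^Fin 1]→L[ℝ] ℝ) (α : E [⋀^Fin k]→L[ℝ] ℝ) :
    wedgeOne (-θ) α = -wedgeOne θ α := by
  rw [eq_neg_iff_add_eq_zero, ← wedgeOne_add_left, neg_add_cancel, wedgeOne, wedge_zero_left,
    castForm_eq_zero]

lemma sum_wedgeOne (a : ι → E [⋀^Fin 1]→L[ℝ] ℝ) (s : Finset ι) (α : E [⋀^Fin k]→L[ℝ] ℝ) :
    wedgeOne (∑ i ∈ s, a i) α = ∑ i ∈ s, wedgeOne (a i) α :=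
  map_sum (⟨⟨fun θ => wedgeOne θ α, fun θ θ' => wedgeOne_add_left θ θ' α⟩,
    fun c θ => wedgeOne_smul_left c θ α⟩ :
    (E [⋀^Fin 1]→L[ℝ] ℝ) →ₗ[ℝ] (E [⋀^Fin (k + 1)]→L[ℝ] ℝ)) a s

lemma sum_lef (a : ι → E [⋀^Fin 2]→L[ℝ] ℝ) (s : Finset ι) (α : E [⋀^Fin k]→L[ℝ] ℝ) :
    lef (∑ i ∈ s, a i) α = ∑ i ∈ s, lef (a i) α :=
  map_sum (⟨⟨fun w => lef w α, fun w w' => by simp only [lef, wedge_add_left, castForm_add]⟩,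
    fun c w => by simp only [lef, wedge_smul_left, castForm_smul, RingHom.id_apply]⟩ :
    (E [⋀^Fin 2]→L[ℝ] ℝ) →ₗ[ℝ] (E [⋀^Fin (k + 2)]→L[ℝ] ℝ)) a s

/-- Euler's identity for `ω`, wedged with `α`. It writes `L` through products with `1`-forms, for
which the contraction rule is known. -/
lemma lef_eq_sum (c : Module.Basis ι ℝ E) (α : E [⋀^Fin k]→L[ℝ] ℝ) :
    (2 : ℝ) • lef om α = ∑ i, wedgeOne (coordForm c i) (wedgeOne (om.curryLeft (c i)) α) := by
  have h := sum_wedgeOne_curryLeft c om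
  have key : ∀ i, wedgeOne (coordForm c i) (wedgeOne (om.curryLeft (c i)) α) =
      lef (wedgeOne (coordForm c i) (om.curryLeft (c i))) α := by
    intro i
    rw [lef, wedgeOne, wedgeOne, wedge_castForm_right, castForm_castForm, ← wedge_assoc,
      castForm_castForm]
    rfl
  simp only [key]
  rw [← sum_lef, h, lef, lef, ← castForm_smul, ← wedge_smul_left]
  norm_num

lemma curryLeft_sum (s : Finset ι) (a : ι → E [⋀^Fin (k + 1)]→L[ℝ] ℝ) :
    (∑ i ∈ s, a i).curryLeft = ∑ i ∈ s, (a i).curryLeft :=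
  map_sum (ContinuousAlternatingMap.curryLeftLI (𝕜 := ℝ) (E := E) (F := ℝ) (n := k)).toLinearMap a s

lemma curryLeft_two_apply (u w : E) : om.curryLeft u (fun _ => w) = om ![u, w] := by
  rw [ContinuousAlternatingMap.curryLeft_apply_apply]
  congr 1
  ext i
  fin_cases i <;> rfl

lemma two_form_swap (u w : E) : om ![u, w] = - om ![w, u] := by
  have h := om.toAlternatingMap.map_swap ![w, u] (show (0 : Fin 2) ≠ 1 by decide)
  have e : ![w, u] ∘ Equiv.swap (0 : Fin 2) 1 = ![u, w] := by
    ext i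
    fin_cases i <;> simp
  rw [e] at h
  exact h

lemma sum_coordForm (c : Module.Basis ι ℝ E) (θ : E [⋀^Fin 1]→L[ℝ] ℝ) :
    ∑ i, θ (fun _ => c i) • coordForm c i = θ := by
  ext w
  have h := congrArg (covec θ) (c.sum_repr (w 0))
  have hw : (fun _ => w 0) = w := by ext i; fin_cases i; rfl
  rw [map_sum, covec_apply θ (w 0), hw] at h
  rw [← h]
  simp [coordForm_apply, covec_apply, mul_comm]

/-- Contract `lef_eq_sum` with `v` once; the terms `eⁱ(v) ι_{eᵢ}ω` add up to `ι_v ω`. The inner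
contraction is left unexpanded so that degree `0` and positive degree can share this formula. -/
lemma two_smul_curryLeft_lef (c : Module.Basis ι ℝ E) (α : E [⋀^Fin k]→L[ℝ] ℝ) (v : E) :
    (2 : ℝ) • (lef om α).curryLeft v = wedgeOne (om.curryLeft v) α -
      ∑ i, wedgeOne (coordForm c i) ((wedgeOne (om.curryLeft (c i)) α).curryLeft v) := by
  have h := congrArg (fun β => ContinuousAlternatingMap.curryLeft β v) (lef_eq_sum om c α)
  simp only [ContinuousAlternatingMap.curryLeft_smul, curryLeft_sum] at h
  simp only [_root_.sum_apply, curryLeft_wedgeOne] at h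
  rw [_root_.smul_apply] at h
  rw [h, Finset.sum_sub_distrib]
  congr 1
  have e2 : ∑ i, coordForm c i (fun _ => v) • om.curryLeft (c i) = om.curryLeft v := by
    conv_rhs => rw [← c.sum_repr v]
    rw [map_sum]
    simp only [map_smul, coordForm_apply]
  simp only [← wedgeOne_smul_left]
  rw [← sum_wedgeOne, e2]

lemma sum_smul_wedgeOne_coordForm (c : Module.Basis ι ℝ E) (α : E [⋀^Fin k]→L[ℝ] ℝ) (v : E) :
    ∑ i, (om.curryLeft (c i) fun _ => v) • wedgeOne (coordForm c i) α =
      - wedgeOne (om.curryLeft v) α := by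
  have e : ∑ i, (om.curryLeft (c i) fun _ => v) • coordForm c i = - om.curryLeft v := by
    rw [← sum_coordForm c (om.curryLeft v)]
    ext w
    simp only [ContinuousAlternatingMap.sum_apply, ContinuousAlternatingMap.neg_apply,
      ContinuousAlternatingMap.smul_apply, ← Finset.sum_neg_distrib]
    refine Finset.sum_congr rfl fun i _ => ?_
    rw [curryLeft_two_apply, curryLeft_two_apply, two_form_swap, smul_eq_mul, smul_eq_mul, neg_mul]
  simp only [← wedgeOne_smul_left]
  rw [← sum_wedgeOne, e, wedgeOne_neg_left]

/-- Expanding the inner contraction gives a second copy of `ι_v ω ∧ α`, by the antisymmetry of `ω`,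
together with `2 ω ∧ ι_v α`; then divide by `2`. -/
lemma curryLeft_lef (α : E [⋀^Fin (k + 1)]→L[ℝ] ℝ) (v : E) :
    (lef om α).curryLeft v = wedgeOne (om.curryLeft v) α + lef om (α.curryLeft v) := by
  have c := Module.finBasis ℝ E
  refine smul_right_injective _ (two_ne_zero (α := ℝ)) ?_
  simp only [two_smul_curryLeft_lef om c α, smul_add, lef_eq_sum om c (α.curryLeft v)]
  simp only [curryLeft_wedgeOne, wedgeOne_sub_right, wedgeOne_smul_right, Finset.sum_sub_distrib]
  rw [sum_smul_wedgeOne_coordForm, two_smul]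
  abel

lemma curryLeft_lef_zero (α : E [⋀^Fin 0]→L[ℝ] ℝ) (v : E) :
    (lef om α).curryLeft v = wedgeOne (om.curryLeft v) α := by
  have c := Module.finBasis ℝ E
  refine smul_right_injective _ (two_ne_zero (α := ℝ)) ?_
  simp only [two_smul_curryLeft_lef om c α, curryLeft_wedgeOne_zero, wedgeOne_smul_right]
  rw [sum_smul_wedgeOne_coordForm, two_smul]
  abel

/-- The interior product is a derivation on the powers of the Lefschetz operator. -/
lemma curryLeft_lefPow_succ (p : ℕ) (α : E [⋀^Fin (k + 1)]→L[ℝ] ℝ) (v : E) :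
    ContinuousAlternatingMap.curryLeft (n := k + 1 + 2 * p + 1) (lefPow om (p + 1) α) v =
      ((p + 1 : ℕ) : ℝ) • wedgeOne (om.curryLeft v) (lefPow om p α) +
        castForm (by omega) (lefPow om (p + 1) (α.curryLeft v)) := by
  induction p with
  | zero =>
    refine (curryLeft_lef om α v).trans ?_
    simp
    rfl
  | succ p ih =>
    refine (curryLeft_lef (k := k + 1 + 2 * p + 1) om (lefPow om (p + 1) α) v).trans ?_
    rw [ih, lef_add, lef_smul, lef_wedgeOne, lef_castForm, ← lefPow_succ, ← lefPow_succ,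
      ← add_assoc]
    congr 1
    push_cast
    module

lemma curryLeft_lefPow_succ_zero (p : ℕ) (α : E [⋀^Fin 0]→L[ℝ] ℝ) (v : E) :
    ContinuousAlternatingMap.curryLeft (n := 0 + 2 * p + 1) (lefPow om (p + 1) α) v =
      ((p + 1 : ℕ) : ℝ) • wedgeOne (om.curryLeft v) (lefPow om p α) := by
  induction p with
  | zero =>
    refine (curryLeft_lef_zero om α v).trans ?_
    simp
    rfl
  | succ p ih =>
    refine (curryLeft_lef (k := 0 + 2 * p + 1) om (lefPow om (p + 1) α) v).trans ?_
    rw [ih, lef_smul, lef_wedgeOne, ← lefPow_succ]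
    push_cast
    module

/-! ### Symplectic linear algebra: injectivity and bijectivity of Lefschetz powers. -/

section Nondegenerate

variable {n : ℕ}

/-- Non-degeneracy makes `v ↦ ι_v ω` injective, and `E` and its dual have equal dimension. -/
lemma exists_curryLeft_eq (hom : ∀ u, (∀ w, om ![u, w] = 0) → u = 0) (θ : E [⋀^Fin 1]→L[ℝ] ℝ) :
    ∃ v, om.curryLeft v = θ := by
  have hinj : Function.Injective
      ((ContinuousAlternatingMap.ofSubsingletonLIE (𝕜 := ℝ) (E := E) (F := ℝ)
        (0 : Fin 1)).symm.toLinearEquiv.toLinearMap ∘ₗ om.curryLeft.toLinearMap) := by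
    rw [injective_iff_map_eq_zero]
    intro u hu
    refine hom u fun w => ?_
    rw [← curryLeft_two_apply]
    exact congrArg (fun f : E →L[ℝ] ℝ => f w) hu
  have hdim : Module.finrank ℝ E = Module.finrank ℝ (E →L[ℝ] ℝ) := by
    rw [← LinearEquiv.finrank_eq (LinearMap.toContinuousLinearMap (𝕜 := ℝ) (E := E) (F' := ℝ)),
      ← Subspace.dual_finrank_eq]
  obtain ⟨v, hv⟩ := (LinearMap.injective_iff_surjective_of_finrank_eq_finrank hdim).1 hinj
    ((ContinuousAlternatingMap.ofSubsingletonLIE (𝕜 := ℝ) (E := E) (F := ℝ) (0 : Fin 1)).symm θ)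
  exact ⟨v, (ContinuousAlternatingMap.ofSubsingletonLIE
    (𝕜 := ℝ) (E := E) (F := ℝ) (0 : Fin 1)).symm.injective hv⟩

/-- Put `β = ω^p α`. Contracting `ω^{p+1} α = 0` gives `ι_v ω ∧ β = 0` for all `v`, so `β` is killed
by every `1`-form. A nonzero form with this property has top degree `2n`, but `deg β = 2p < 2n`. -/
lemma lefPow_eq_zero_of_succ (hom : ∀ u, (∀ w, om ![u, w] = 0) → u = 0)
    (hE : Module.finrank ℝ E = 2 * n) {p : ℕ} (hp : p < n) (α : E [⋀^Fin 0]→L[ℝ] ℝ)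
    (h : lefPow om (p + 1) α = 0) : lefPow om p α = 0 := by
  have c : Module.Basis (Fin (2 * n)) ℝ E := Module.finBasisOfFinrankEq ℝ E hE
  choose b hb using fun i => exists_curryLeft_eq om hom (coordForm c i)
  have h1 : ∀ v, wedgeOne (om.curryLeft v) (lefPow om p α) = 0 := by
    intro v
    have := curryLeft_lefPow_succ_zero om p α v
    rw [h] at this
    have h0 : ((p + 1 : ℕ) : ℝ) ≠ 0 := by positivity
    exact (smul_eq_zero.1 this.symm).resolve_left h0
  have hc : ∀ i, coordForm c i (fun _ => c i) = 1 := by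
    intro i
    rw [coordForm_apply]
    simp
  cases p with
  | zero =>
    have h2 := congrArg (fun β => ContinuousAlternatingMap.curryLeft β (c ⟨0, by omega⟩))
      (h1 (b ⟨0, by omega⟩))
    simp only [hb] at h2
    have h3 := curryLeft_wedgeOne_zero (coordForm c ⟨0, by omega⟩) α (c ⟨0, by omega⟩)
    rw [hc, one_smul] at h3
    exact h3.symm.trans h2
  | succ p =>
    -- Contracting `eⁱ ∧ β = 0` with `eᵢ` gives `eⁱ ∧ ι_{eᵢ} β = β`.
    have h2 : ∀ i, wedgeOne (coordForm c i) (ContinuousAlternatingMap.curryLeft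
        (n := 0 + 2 * p + 1) (lefPow om (p + 1) α) (c i)) = lefPow om (p + 1) α := by
      intro i
      have h3 := curryLeft_wedgeOne (k := 0 + 2 * p + 1) (coordForm c i) (lefPow om (p + 1) α) (c i)
      have h4 := congrArg (fun β => ContinuousAlternatingMap.curryLeft β (c i)) (h1 (b i))
      simp only [hb] at h4
      rw [hc, one_smul] at h3
      exact (sub_eq_zero.1 (h3.symm.trans h4)).symm
    have h3 := sum_wedgeOne_curryLeft (k := 0 + 2 * p + 1) c (lefPow om (p + 1) α)
    simp only [h2] at h3
    -- The same sum equals `2n β` and, by Euler's identity, `(deg β) β`.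
    rw [Finset.sum_const, Finset.card_univ, Fintype.card_fin, ← Nat.cast_smul_eq_nsmul ℝ,
      ← sub_eq_zero, ← sub_smul] at h3
    refine (smul_eq_zero.1 h3).resolve_left ?_
    exact sub_ne_zero.2 (Nat.cast_injective.ne (by omega))

/-- Induction on the degree of `α`. If `L^p α = 0`, then `L^{p+1} α = 0` as well; contracting the
latter, the term with `L^p α` drops out and leaves `L^{p+1}(ι_v α) = 0`. The bound `k + p ≤ n`
survives since the degree falls by one as the power rises by one. -/
lemma lefPow_injective (hom : ∀ u, (∀ w, om ![u, w] = 0) → u = 0)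
    (hE : Module.finrank ℝ E = 2 * n) {p : ℕ} (hp : k + p ≤ n) (α : E [⋀^Fin k]→L[ℝ] ℝ)
    (h : lefPow om p α = 0) : α = 0 := by
  induction k generalizing p with
  | zero =>
    induction p with
    | zero => exact h
    | succ p ih => exact ih (by omega) (lefPow_eq_zero_of_succ om hom hE (by omega) α h)
  | succ k ih =>
    have key : ∀ v, lefPow om (p + 1) (α.curryLeft v) = 0 := by
      intro v
      have h1 := curryLeft_lefPow_succ om p α v
      rw [lefPow_succ, h, lef_zero] at h1
      have h2 : wedgeOne (om.curryLeft v) (0 : E [⋀^Fin (k + 1 + 2 * p)]→L[ℝ] ℝ) = 0 := by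
        simpa using wedgeOne_smul_right (om.curryLeft v) 0 (0 : E [⋀^Fin (k + 1 + 2 * p)]→L[ℝ] ℝ)
      rw [h2, smul_zero, zero_add] at h1
      exact castForm_eq_zero.1 h1.symm
    -- A form of positive degree is determined by its contractions.
    ext w
    have := ih (p := p + 1) (by omega) (α.curryLeft (w 0)) (key _)
    have h3 := congrArg (fun β => β (Fin.tail w)) this
    simp only [ContinuousAlternatingMap.curryLeft_apply_apply] at h3
    have hw : Matrix.vecCons (w 0) (Fin.tail w) = w := Fin.cons_self_tail w
    rwa [hw] at h3

/-- In coordinates the map is a polynomial. This identifies continuous with algebraic alternating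
forms, whose dimension is that of an exterior power. -/
lemma continuous_alternatingMap (f : E [⋀^Fin k]→ₗ[ℝ] ℝ) : Continuous f := by
  have c := Module.finBasis ℝ E
  have h : ∀ v : Fin k → E, f v = ∑ r : Fin k → Fin (Module.finrank ℝ E),
      (∏ i, c.repr (v i) (r i)) * f (fun i => c (r i)) := by
    intro v
    have h1 := f.toMultilinearMap.map_sum (fun i j => c.repr (v i) j • c j)
    simp only [c.sum_repr] at h1
    refine h1.trans (Finset.sum_congr rfl fun r _ => ?_)
    exact f.toMultilinearMap.map_smul_univ (fun i => c.repr (v i) (r i)) (fun i => c (r i))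
  have hc : ∀ j, Continuous fun u : E => c.repr u j := fun j =>
    (c.coord j).continuous_of_finiteDimensional
  rw [show (f : (Fin k → E) → ℝ) = _ from funext h]
  exact continuous_finsetSum _ fun r _ => (continuous_finsetProd _ fun i _ =>
    (hc _).comp (continuous_apply i)).mul continuous_const

/-- On a finite-dimensional space all alternating forms are continuous. -/
def alternatingMapEquiv (E : Type*) [NormedAddCommGroup E] [NormedSpace ℝ E]
    [FiniteDimensional ℝ E] (k : ℕ) : (E [⋀^Fin k]→L[ℝ] ℝ) ≃ₗ[ℝ] (E [⋀^Fin k]→ₗ[ℝ] ℝ) :=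
  LinearEquiv.ofBijective ContinuousAlternatingMap.toAlternatingMapLinear
    ⟨ContinuousAlternatingMap.toAlternatingMap_injective,
      fun f => ⟨⟨⟨f.toMultilinearMap, continuous_alternatingMap f⟩, f.map_eq_zero_of_eq'⟩, rfl⟩⟩

instance finiteDimensional_forms : FiniteDimensional ℝ (E [⋀^Fin k]→L[ℝ] ℝ) :=
  Module.Finite.equiv ((alternatingMapEquiv E k).trans
    exteriorPower.alternatingMapLinearEquiv).symm

lemma finrank_forms :
    Module.finrank ℝ (E [⋀^Fin k]→L[ℝ] ℝ) = (Module.finrank ℝ E).choose k := by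
  rw [((alternatingMapEquiv E k).trans
    (exteriorPower.alternatingMapLinearEquiv (N := ℝ))).finrank_eq, ← exteriorPower.finrank_eq]
  exact Subspace.dual_finrank_eq

lemma form_eq_zero_of_finrank_lt (h : Module.finrank ℝ E < k) (α : E [⋀^Fin k]→L[ℝ] ℝ) :
    α = 0 := by
  have h0 : Module.finrank ℝ (E [⋀^Fin k]→L[ℝ] ℝ) = 0 := by
    rw [finrank_forms, Nat.choose_eq_zero_of_lt h]
  have := Module.finrank_zero_iff.1 h0
  exact Subsingleton.elim _ _

/-- Transport along an equality of degrees, as a continuous linear map. -/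
def castFormCLM (E : Type*) [NormedAddCommGroup E] [NormedSpace ℝ E]
    [FiniteDimensional ℝ E] (h : k = l) :
    (E [⋀^Fin k]→L[ℝ] ℝ) →L[ℝ] (E [⋀^Fin l]→L[ℝ] ℝ) :=
  LinearMap.toContinuousLinearMap ⟨⟨castForm h, castForm_add h⟩, castForm_smul h⟩

/-- The power of the Lefschetz operator, as a continuous linear map. -/
def lefPowCLM (k : ℕ) : (p : ℕ) → (E [⋀^Fin k]→L[ℝ] ℝ) →L[ℝ] (E [⋀^Fin (k + 2 * p)]→L[ℝ] ℝ)
  | 0 => ContinuousLinearMap.id ℝ _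
  | p + 1 => (castFormCLM E (Nat.add_comm 2 (k + 2 * p)) ∘L wedgeCLM E 2 (k + 2 * p) om) ∘L
      lefPowCLM k p

lemma lefPowCLM_apply (p : ℕ) (α : E [⋀^Fin k]→L[ℝ] ℝ) : lefPowCLM om k p α = lefPow om p α := by
  induction p with
  | zero => rfl
  | succ p ih => rw [lefPow_succ, ← ih]; rfl

/-- `L^p` depends polynomially on `ω`. This serves the smoothness of the inverse of `L^p` along a
chart. -/
lemma contDiff_lefPowCLM (k p : ℕ) :
    ContDiff ℝ ∞ (fun om : E [⋀^Fin 2]→L[ℝ] ℝ => lefPowCLM om k p) := by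
  induction p with
  | zero => exact contDiff_const
  | succ p ih =>
    have h0 : ContDiff ℝ ∞ (fun om : E [⋀^Fin 2]→L[ℝ] ℝ => wedgeCLM E 2 (k + 2 * p) om) := by
      fun_prop
    have h1 : ContDiff ℝ ∞ (fun _ : E [⋀^Fin 2]→L[ℝ] ℝ =>
      castFormCLM E (Nat.add_comm 2 (k + 2 * p))) := contDiff_const
    exact (h1.clm_comp h0).clm_comp ih

lemma exists_continuousLinearEquiv {A B : Type*} [NormedAddCommGroup A] [NormedSpace ℝ A]
    [NormedAddCommGroup B] [NormedSpace ℝ B] [FiniteDimensional ℝ A] [FiniteDimensional ℝ B]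
    (f : A →L[ℝ] B) (hf : Function.Injective f)
    (h : Module.finrank ℝ A = Module.finrank ℝ B) : ∃ e : A ≃L[ℝ] B, (e : A →L[ℝ] B) = f :=
  ⟨(LinearEquiv.ofInjectiveOfFinrankEq f.toLinearMap hf h).toContinuousLinearEquiv, by ext; rfl⟩

/-- Injectivity suffices, since `k` and `k + 2p` are complementary in `2n` and the binomial
coefficients agree. -/
lemma exists_lefPow_equiv (hom : ∀ u, (∀ w, om ![u, w] = 0) → u = 0)
    (hE : Module.finrank ℝ E = 2 * n) {p : ℕ} (hp : k + p = n) :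
    ∃ e : (E [⋀^Fin k]→L[ℝ] ℝ) ≃L[ℝ] (E [⋀^Fin (k + 2 * p)]→L[ℝ] ℝ),
      (e : (E [⋀^Fin k]→L[ℝ] ℝ) →L[ℝ] (E [⋀^Fin (k + 2 * p)]→L[ℝ] ℝ)) = lefPowCLM om k p := by
  refine exists_continuousLinearEquiv _ ?_ ?_
  · rw [injective_iff_map_eq_zero]
    intro α hα
    exact lefPow_injective om hom hE hp.le α ((lefPowCLM_apply om p α).symm.trans hα)
  · rw [finrank_forms, finrank_forms, hE]
    exact Nat.choose_symm_of_eq_add (by omega)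

end Nondegenerate

end PointwiseLefschetz

/-! ### Leibniz rules for `d` and `d_c`, and degree bookkeeping. -/

section Leibniz

variable {E : Type*} [NormedAddCommGroup E] [NormedSpace ℝ E]
  {M : Type*} [TopologicalSpace M] [ChartedSpace E M] {k l : ℕ}

lemma rep_wedge (α : Form E M k) (β : Form E M l) (x₀ : M) (y : E) :
    rep (α.wedge β).1 x₀ y = wedge (rep α.1 x₀ y) (rep β.1 x₀ y) :=
  wedge_comp (V := E) (W := E) _ _ _

lemma rep_add (α β : Form E M k) (x₀ : M) (y : E) :
    rep (α + β).1 x₀ y = rep α.1 x₀ y + rep β.1 x₀ y := rfl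

lemma rep_smul (c : ℝ) (α : Form E M k) (x₀ : M) (y : E) :
    rep (c • α).1 x₀ y = c • rep α.1 x₀ y := rfl

variable [IsManifold 𝓘(ℝ, E) ∞ M]

lemma rep_cast (h : k = l) (α : Form E M k) (x₀ : M) (y : E) :
    rep (α.cast h).1 x₀ y = castForm h (rep α.1 x₀ y) := by
  subst h; rfl

lemma form_ext {α β : Form E M k}
    (h : ∀ x₀ : M, ∀ y ∈ (extChartAt 𝓘(ℝ, E) x₀).target, rep α.1 x₀ y = rep β.1 x₀ y) :
    α = β := by
  rw [← sub_eq_zero]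
  refine form_eq_zero _ fun x₀ y hy => ?_
  have : rep (α - β).1 x₀ y = rep α.1 x₀ y - rep β.1 x₀ y := rfl
  rw [this, h x₀ y hy, sub_self]

variable [FiniteDimensional ℝ E]

lemma alternatizeUncurryFin_smulRight (θ : E [⋀^Fin 1]→L[ℝ] ℝ) (α : E [⋀^Fin k]→L[ℝ] ℝ) :
    ContinuousAlternatingMap.alternatizeUncurryFin ((covec θ).smulRight α) = wedgeOne θ α := by
  ext v
  simp [ContinuousAlternatingMap.alternatizeUncurryFin_apply, covec_apply, wedgeOne_apply]

lemma rep_lichD_eq (θ : Form E M 1) (c : ℤ) (α : Form E M k) (x₀ : M) (y : E)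
    (hy : y ∈ (extChartAt 𝓘(ℝ, E) x₀).target) :
    rep (lichD θ c α).1 x₀ y =
      ContinuousAlternatingMap.alternatizeUncurryFin (fderiv ℝ (rep α.1 x₀) y) +
        (c : ℝ) • wedgeOne (rep θ.1 x₀ y) (rep α.1 x₀ y) := by
  rw [rep_lichD θ c α x₀ y hy, ContinuousAlternatingMap.alternatizeUncurryFinCLM_apply,
    ContinuousAlternatingMap.alternatizeUncurryFin_add,
    ContinuousAlternatingMap.alternatizeUncurryFin_smul, alternatizeUncurryFin_smulRight]

/-- The Leibniz rule on a normed space. -/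
lemma extDeriv_wedge {a : E → E [⋀^Fin k]→L[ℝ] ℝ} {b : E → E [⋀^Fin l]→L[ℝ] ℝ} {y : E}
    (ha : DifferentiableAt ℝ a y) (hb : DifferentiableAt ℝ b y) :
    extDeriv (fun z => wedge (a z) (b z)) y =
      castForm (Nat.add_right_comm k 1 l) (wedge (extDeriv a y) (b y)) +
        (-1 : ℝ) ^ k • (wedge (a y) (extDeriv b y) : E [⋀^Fin (k + (l + 1))]→L[ℝ] ℝ) := by
  have c := Module.finBasis ℝ E
  have hd : ∀ u, fderiv ℝ (fun z => wedge (a z) (b z)) y u =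
      wedge (fderiv ℝ a y u) (b y) + wedge (a y) (fderiv ℝ b y u) := by
    intro u
    have := (wedgeCLM E k l).fderiv_of_bilinear ha hb
    exact (congrArg (fun f : E →L[ℝ] _ => f u) this).trans (add_comm _ _)
  have hl : ∀ s : Finset (Fin (Module.finrank ℝ E)), ∀ f : _ → E [⋀^Fin (k + 1)]→L[ℝ] ℝ,
      castForm (Nat.add_right_comm k 1 l) (wedge (∑ i ∈ s, f i) (b y)) =
      ∑ i ∈ s, castForm (Nat.add_right_comm k 1 l) (wedge (f i) (b y)) := fun s f =>
    map_sum (castFormCLM E (Nat.add_right_comm k 1 l) ∘L (wedgeCLM E (k + 1) l).flip (b y)) f s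
  have hr : ∀ s : Finset (Fin (Module.finrank ℝ E)), ∀ f : _ → E [⋀^Fin (l + 1)]→L[ℝ] ℝ,
      wedge (a y) (∑ i ∈ s, f i) = ∑ i ∈ s, wedge (a y) (f i) := fun s f =>
    map_sum (wedgeCLM E k (l + 1) (a y)) f s
  simp only [extDeriv]
  rw [alternatizeUncurryFin_eq_sum c, alternatizeUncurryFin_eq_sum c,
    alternatizeUncurryFin_eq_sum c, hl, hr, Finset.smul_sum, ← Finset.sum_add_distrib]
  -- Compare the coefficients of each `eⁱ ∧ ∂ᵢ`; moving `eⁱ` past `a` costs `(-1)^k`, which cancels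
  -- the explicit sign.
  refine Finset.sum_congr rfl fun i _ => ?_
  rw [hd, wedgeOne_add_right, castForm_wedgeOne_wedge, wedge_wedgeOne, smul_smul, ← mul_pow]
  norm_num

/-- The Leibniz rule for the twisted differentials. -/
lemma lichD_wedge (θ : Form E M 1) (c c' : ℤ) (α : Form E M k) (β : Form E M l) :
    lichD θ (c + c') (α.wedge β) = ((lichD θ c α).wedge β).cast (Nat.add_right_comm k 1 l) +
      (-1 : ℝ) ^ k • (α.wedge (lichD θ c' β) : Form E M (k + (l + 1))) := by
  refine form_ext fun x₀ y hy => ?_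
  have h1 := extDeriv_wedge (differentiableAt_rep α hy) (differentiableAt_rep β hy)
  have h2 : rep (α.wedge β).1 x₀ = fun z => wedge (rep α.1 x₀ z) (rep β.1 x₀ z) :=
    funext fun z => rep_wedge α β x₀ z
  simp only [extDeriv] at h1
  rw [rep_add, rep_smul, rep_cast, rep_wedge (k := k + 1), rep_wedge (l := l + 1),
    rep_lichD_eq _ _ _ _ _ hy, rep_lichD_eq _ _ _ _ _ hy, rep_lichD_eq _ _ _ _ _ hy, h2, h1,
    wedge_add_left, wedge_add_right, castForm_add, wedge_smul_left, wedge_smul_right,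
    castForm_smul, castForm_wedgeOne_wedge, wedge_wedgeOne]
  have h3 : ((-1 : ℝ) ^ k) * (-1) ^ k = 1 := by rw [← mul_pow]; norm_num
  rw [smul_add, smul_comm ((-1 : ℝ) ^ k) (c' : ℝ), smul_smul ((-1 : ℝ) ^ k), h3, one_smul]
  push_cast
  module

lemma lichD_cast (θ : Form E M 1) (c : ℤ) (h : k = l) (α : Form E M k) :
    lichD θ c (α.cast h) = (lichD θ c α).cast (congrArg (· + 1) h) := by
  subst h; rfl

lemma cast_cast {m : ℕ} (h : k = l) (h' : l = m) (α : Form E M k) :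
    (α.cast h).cast h' = α.cast (h.trans h') := by
  subst h; rfl

lemma lefschetz_cast (om : Form E M 2) (h : k = l) (α : Form E M k) :
    lefschetz om (α.cast h) = (lefschetz om α).cast (congrArg (· + 2) h) := by
  subst h; rfl

lemma lefschetzPow_cast (om : Form E M 2) (p : ℕ) (h : k = l) (α : Form E M k) :
    lefschetzPow om p (α.cast h) = (lefschetzPow om p α).cast (congrArg (· + 2 * p) h) := by
  subst h; rfl

lemma lefschetzPow_succ (om : Form E M 2) (p : ℕ) (α : Form E M k) :
    lefschetzPow om (p + 1) α = lefschetz om (lefschetzPow om p α) := rfl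

lemma cast_injective (h : k = l) : Function.Injective (Form.cast (E := E) (M := M) h) := by
  subst h; exact fun _ _ h => h

lemma cast_zero (h : k = l) : (0 : Form E M k).cast h = 0 := by
  subst h; rfl

lemma lefschetzPow_add (om : Form E M 2) (q p : ℕ) (α : Form E M k) :
    lefschetzPow om q (lefschetzPow om p α) = (lefschetzPow om (p + q) α).cast (by ring) := by
  induction q with
  | zero => rfl
  | succ q ih =>
    rw [lefschetzPow_succ, ih, lefschetz_cast]
    rfl

lemma omegaPow_wedge (om : Form E M 2) (p : ℕ) (α : Form E M k) :
    (omegaPow om p).wedge α = (lefschetzPow om p α).cast (Nat.add_comm _ _) := by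
  induction p with
  | zero =>
    ext1
    funext x
    exact (castForm_comm (E := E) _ _).1 (wedge_constOfIsEmpty (V := E) (α.1 x))
  | succ p ih =>
    rw [lefschetzPow_succ]
    have h1 : (omegaPow om (p + 1)).wedge α =
        (lefschetz om ((omegaPow om p).wedge α)).cast (by ring) := by
      ext1
      funext x
      refine (castForm_comm (E := E) (h := by ring) _ _).1 ?_
      refine Eq.trans ?_ (castForm_lef_wedge (V := E) (om.1 x) ((omegaPow om p).1 x) (α.1 x))
      rfl
    rw [h1, ih, lefschetz_cast, cast_cast]

end Leibniz

/-! ### The Lefschetz filtration on differential forms and its strictness. -/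

section LefschetzForms

variable {E : Type*} [NormedAddCommGroup E] [NormedSpace ℝ E] [FiniteDimensional ℝ E]
  {M : Type*} [TopologicalSpace M] [ChartedSpace E M] [IsManifold 𝓘(ℝ, E) ∞ M] {k l n : ℕ}

/-- The twisted Leibniz rule with the twist split as `c = 1 + (c - 1)`: the term `d_1 ω ∧ α`
vanishes and the sign is `(-1)^2`. -/
lemma lichD_lefschetz (θ : Form E M 1) (om : Form E M 2) (hom : lichD θ 1 om = 0) (c : ℤ)
    (α : Form E M k) : lichD θ c (lefschetz om α) = lefschetz om (lichD θ (c - 1) α) := by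
  have h := lichD_wedge θ 1 (c - 1) om α
  have h0 : (0 : Form E M 3).wedge α = 0 := by
    ext1
    funext x
    exact wedge_zero_left (V := E) _
  rw [hom, h0, cast_zero, zero_add, add_sub_cancel] at h
  norm_num at h
  change lichD θ c ((om.wedge α).cast _) = (om.wedge (lichD θ (c - 1) α)).cast _
  rw [lichD_cast, h]

lemma lichD_lefschetzPow (θ : Form E M 1) (om : Form E M 2) (hom : lichD θ 1 om = 0) (c : ℤ)
    (p : ℕ) (α : Form E M k) : lichD θ c (lefschetzPow om p α) =
      (lefschetzPow om p (lichD θ (c - p) α)).cast (by ring) := by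
  induction p generalizing c with
  | zero => simp; rfl
  | succ p ih =>
    rw [lefschetzPow_succ, lichD_lefschetz θ om hom, ih, lefschetz_cast, lefschetzPow_succ]
    have : c - 1 - (p : ℤ) = c - ((p + 1 : ℕ) : ℤ) := by push_cast; ring
    rw [this]

lemma lefschetzPow_val (om : Form E M 2) (p : ℕ) (α : Form E M k) (x : M) :
    (lefschetzPow om p α).1 x = lefPow (E := E) (om.1 x) p (α.1 x) := by
  induction p with
  | zero => rfl
  | succ p ih => exact congrArg (lef (V := E) (om.1 x)) ih

/-- A `2`-form is non-degenerate. -/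
def Nondegenerate (om : Form E M 2) : Prop :=
  ∀ (x : M) (u : TangentSpace 𝓘(ℝ, E) x),
    (∀ w : TangentSpace 𝓘(ℝ, E) x, om.1 x ![u, w] = 0) → u = 0

lemma lefschetzPow_eq_zero {om : Form E M 2} (hom : Nondegenerate om)
    (hE : Module.finrank ℝ E = 2 * n) {p : ℕ} (hp : k + p ≤ n) {α : Form E M k}
    (h : lefschetzPow om p α = 0) : α = 0 := by
  ext1
  funext x
  refine lefPow_injective (E := E) (om.1 x) (hom x) hE hp (α.1 x) ?_
  rw [← lefschetzPow_val, h]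
  rfl

/-- The derivative of the inverse chart is invertible, and pull-back along an isomorphism preserves
non-degeneracy. -/
lemma rep_nondegenerate {om : Form E M 2} (hom : Nondegenerate om) (x₀ : M) (y : E)
    (hy : y ∈ (extChartAt 𝓘(ℝ, E) x₀).target) (u : E)
    (hu : ∀ w, rep om.1 x₀ y ![u, w] = 0) : u = 0 := by
  have := IsManifold.of_le (I := 𝓘(ℝ, E)) (M := M) (m := 1) (n := ∞) (by simp)
  have hinv := isInvertible_mfderivWithin_extChartAt_symm (I := 𝓘(ℝ, E)) hy
  rw [modelWithCornersSelf_coe, Set.range_id, mfderivWithin_univ] at hinv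
  have hbij := hinv.bijective
  have hrep : ∀ w : E, rep om.1 x₀ y ![u, w] = om.1 ((extChartAt 𝓘(ℝ, E) x₀).symm y)
      ![mfderiv 𝓘(ℝ, E) 𝓘(ℝ, E) (extChartAt 𝓘(ℝ, E) x₀).symm y u,
        mfderiv 𝓘(ℝ, E) 𝓘(ℝ, E) (extChartAt 𝓘(ℝ, E) x₀).symm y w] := by
    intro w
    refine congrArg (om.1 ((extChartAt 𝓘(ℝ, E) x₀).symm y)) ?_
    ext i
    fin_cases i <;> rfl
  have h0 : mfderiv 𝓘(ℝ, E) 𝓘(ℝ, E) (extChartAt 𝓘(ℝ, E) x₀).symm y u = 0 := by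
    refine hom _ _ fun w => ?_
    obtain ⟨w, rfl⟩ := hbij.2 w
    exact (hrep w).symm.trans (hu w)
  exact hbij.1 (h0.trans (map_zero _).symm)

/-- On a `2n`-dimensional manifold `L^p : Ω^{n-p} → Ω^{n+p}` is surjective. -/
lemma lefschetzPow_surjective {om : Form E M 2} (hom : Nondegenerate om)
    (hE : Module.finrank ℝ E = 2 * n) {p : ℕ} (hp : k + p = n) :
    Function.Surjective (lefschetzPow om p : Form E M k →ₗ[ℝ] Form E M (k + 2 * p)) := by
  intro α
  -- The preimage is defined pointwise, independently of charts; smoothness is checked afterwards.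
  let b : ∀ x : M, E [⋀^Fin k]→L[ℝ] ℝ := fun x =>
    (lefPowCLM (E := E) (om.1 x) k p).inverse (α.1 x)
  have hb : ∀ x, lefPow (E := E) (om.1 x) p (b x) = α.1 x := by
    intro x
    obtain ⟨e, he⟩ := exists_lefPow_equiv (E := E) (om.1 x) (hom x) hE hp
    refine (lefPowCLM_apply (E := E) (om.1 x) p (b x)).symm.trans ?_
    have h1 : b x = e.symm (α.1 x) := by
      simp only [b, ← he, ContinuousLinearMap.inverse_equiv]
      rfl
    rw [h1, ← he]
    exact e.apply_symm_apply _
  -- Pull-back commutes with `L^p`, so in a chart `b` is again the inverse operator applied to the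
  -- representation of `α`.
  have hrep : ∀ x₀ : M, ∀ y ∈ (extChartAt 𝓘(ℝ, E) x₀).target,
      rep (E := E) (M := M) b x₀ y =
        (lefPowCLM (rep om.1 x₀ y) k p).inverse (rep α.1 x₀ y) := by
    intro x₀ y hy
    obtain ⟨e, he⟩ := exists_lefPow_equiv (rep om.1 x₀ y) (rep_nondegenerate hom x₀ y hy) hE hp
    have h1 : lefPow (rep om.1 x₀ y) p (rep (E := E) (M := M) b x₀ y) = rep α.1 x₀ y := by
      refine (lefPow_comp (E := E) (F := E) _ p _ _).symm.trans ?_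
      exact congrArg (fun η : E [⋀^Fin (k + 2 * p)]→L[ℝ] ℝ => η.compContinuousLinearMap
        (mfderiv 𝓘(ℝ, E) 𝓘(ℝ, E) (extChartAt 𝓘(ℝ, E) x₀).symm y)) (hb _)
    rw [← h1, ← lefPowCLM_apply, ← he, ContinuousLinearMap.inverse_equiv]
    exact (e.symm_apply_apply _).symm
  refine ⟨⟨b, fun x₀ => ?_⟩, ?_⟩
  · refine ContDiffOn.congr ?_ (hrep x₀)
    intro y hy
    refine ContDiffAt.contDiffWithinAt ?_
    have hnhds := (isOpen_target x₀).mem_nhds hy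
    obtain ⟨e, he⟩ := exists_lefPow_equiv (rep om.1 x₀ y) (rep_nondegenerate hom x₀ y hy) hE hp
    have h1 : ContDiffAt ℝ ∞ (fun z => lefPowCLM (rep om.1 x₀ z) k p) y :=
      (contDiff_lefPowCLM (E := E) k p).contDiffAt.comp y ((contDiffOn_rep om x₀).contDiffAt hnhds)
    have h2 : ContDiffAt ℝ ∞ ContinuousLinearMap.inverse (lefPowCLM (rep om.1 x₀ y) k p) := by
      rw [← he]
      exact contDiffAt_map_inverse e
    exact (h2.comp y h1).clm_apply ((contDiffOn_rep α x₀).contDiffAt hnhds)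
  · ext1
    funext x
    rw [lefschetzPow_val]
    exact hb x

/-- In degree `n + s` with `q ≤ s ≤ n` every form is `L^s β = L^q (L^{s-q} β)`; above degree `2n`
all forms vanish. -/
lemma mem_lefschetzFiltration_of_le {om : Form E M 2} (hom : Nondegenerate om)
    (hE : Module.finrank ℝ E = 2 * n) {q : ℕ} (hq : n + q ≤ k) (α : Form E M k) :
    α ∈ lefschetzFiltration om q k := by
  rcases lt_or_ge (2 * n) k with hk | hk
  · refine Or.inr ?_
    ext1
    funext x
    exact form_eq_zero_of_finrank_lt (E := E) (hE.trans_lt hk) (α.1 x)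
  · obtain ⟨s, rfl⟩ := Nat.exists_eq_add_of_le (le_trans (Nat.le_add_right n q) hq)
    obtain ⟨r, rfl⟩ := Nat.exists_eq_add_of_le' (show q ≤ s by omega)
    obtain ⟨j, rfl⟩ := Nat.exists_eq_add_of_le' (show r + q ≤ n by omega)
    obtain ⟨β, hβ⟩ := lefschetzPow_surjective hom hE (k := j) (p := r + q) rfl
      (α.cast (by ring))
    refine Or.inl ⟨j + 2 * r, by ring, lefschetzPow om r β, ?_⟩
    rw [lefschetzPow_add, hβ, cast_cast, cast_cast]
    rfl

lemma lefschetzFiltration_antitone (om : Form E M 2) {p q : ℕ} (h : p ≤ q) (k : ℕ) :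
    lefschetzFiltration om q k ≤ lefschetzFiltration om p k := by
  obtain ⟨r, rfl⟩ := Nat.exists_eq_add_of_le' h
  rintro _ (⟨j, rfl, β, rfl⟩ | rfl)
  · refine Or.inl ⟨j + 2 * r, by ring, lefschetzPow om r β, ?_⟩
    rw [lefschetzPow_add, cast_cast]
  · exact Submodule.zero_mem _

lemma lefschetzFiltration_zero (om : Form E M 2) (k : ℕ) (α : Form E M k) :
    α ∈ lefschetzFiltration om 0 k :=
  Or.inl ⟨k, rfl, α, rfl⟩

/-- If `ω^{t+1}` is `d_{t+1}`-exact, every exact form of filtration degree `p` is the differential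
of a form of filtration degree `p - (t + 1)`. -/
lemma exists_primitive_of_omegaPow_exact {θ : Form E M 1} {om : Form E M 2}
    (hom : Nondegenerate om) (hE : Module.finrank ℝ E = 2 * n) (hd : lichD θ 1 om = 0)
    (hθ : extD θ = 0) {t : ℕ} (ρ : Form E M (2 * t + 1))
    (hρ : lichD θ (t + 1 : ℕ) ρ = omegaPow om (t + 1)) (c : ℤ) (p : ℕ) (α : Form E M k)
    (hα : lichD θ c α ∈ lefschetzFiltration om p (k + 1)) :
    ∃ β ∈ lefschetzFiltration om (p - (t + 1)) k, lichD θ c β = lichD θ c α := by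
  rcases lt_or_ge p (t + 1) with hp | hp
  · exact ⟨α, by rw [Nat.sub_eq_zero_of_le hp.le]; exact lefschetzFiltration_zero om k α, rfl⟩
  obtain ⟨q, rfl⟩ := Nat.exists_eq_add_of_le hp
  rw [Nat.add_sub_cancel_left]
  obtain ⟨j, hj, a, ha⟩ | h0 := hα
  swap
  · exact ⟨0, Submodule.zero_mem _, by rw [map_zero, Set.mem_singleton_iff.1 h0]⟩
  rcases lt_or_ge n (j + 1 + (t + 1 + q)) with hjn | hjn
  · exact ⟨α, mem_lefschetzFiltration_of_le hom hE (by omega) α, rfl⟩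
  obtain rfl : k = 2 * t + 1 + j + 2 * q := by omega
  -- `L^p` is injective in degree `j + 1`, the degree of the differential of `a`, and it kills this
  -- differential because `d_c d_c α = 0`.
  have hclosed : lichD θ (c - (t + 1 + q : ℕ)) a = 0 := by
    refine lefschetzPow_eq_zero hom hE hjn ?_
    have h1 := lichD_lichD θ hθ c α
    rw [ha, lichD_cast, lichD_lefschetzPow θ om hd, cast_cast] at h1
    exact cast_injective _ (h1.trans (cast_zero _).symm)
  -- Trade `t + 1` of the factors `ω` in `ω^{t+1+q} ∧ a` for the primitive `ρ`.
  refine ⟨lefschetzPow om q (ρ.wedge a), Or.inl ⟨_, rfl, _, rfl⟩, ?_⟩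
  have h2 := lichD_wedge θ (t + 1 : ℕ) (c - (t + 1 + q : ℕ)) ρ a
  have h3 : ρ.wedge (0 : Form E M (j + 1)) = 0 := by
    ext1
    funext x
    exact wedge_zero_right (V := E) _
  -- The twists of `ρ` and `a` add up to `c - q`, exactly the one that `L^q` carries to `c`.
  have h4 : ((t + 1 : ℕ) : ℤ) + (c - (t + 1 + q : ℕ)) = c - q := by push_cast; ring
  rw [hclosed, h3, smul_zero, hρ, h4] at h2
  have h5 := omegaPow_wedge om (t + 1) a
  have h6 : lichD θ (c - q) (ρ.wedge a) =
      (lefschetzPow om (t + 1) a).cast (by ring) := by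
    rw [h2]
    refine (add_zero _).trans ?_
    refine (congrArg (Form.cast _) h5).trans ?_
    rw [cast_cast]
  rw [lichD_lefschetzPow θ om hd, h6, lefschetzPow_cast, lefschetzPow_add, cast_cast, cast_cast,
    ha]

end LefschetzForms

/-! ### A degeneration criterion for filtered complexes. -/

section Criterion

variable {K : ℕ → Type*} [∀ k, AddCommGroup (K k)] [∀ k, Module ℝ (K k)]
  {d : ∀ k, K k →ₗ[ℝ] K (k + 1)} {F : ℕ → ∀ k, Submodule ℝ (K k)}

/-- If every exact element of filtration degree `p` is the differential of an element of filtration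
degree `p - T`, then the spectral sequence stabilizes at the term `E_{T+1}`. -/
theorem stabilizesAt_of_strict (hd : ∀ k x, d (k + 1) (d k x) = 0)
    (hF : ∀ p q k, p ≤ q → F q k ≤ F p k) (T : ℕ)
    (hT : ∀ p k (x : K k), d k x ∈ F p (k + 1) → ∃ z ∈ F (p - T) k, d k z = d k x) :
    StabilizesAt d F hd (T + 1) where
  differential_eq_zero r hr p k := by
    refine LinearMap.ext fun y => ?_
    obtain ⟨⟨x, hx⟩, rfl⟩ := Submodule.Quotient.mk_surjective _ y
    obtain ⟨z, hz, hzx⟩ := hT (p + r) k x hx.2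
    refine (Submodule.Quotient.mk_eq_zero _).2 (Submodule.mem_sup_right ?_)
    refine ⟨hx.2, z, ?_, hzx⟩
    -- The denominator at `p + r` admits differentials of elements of `F^{p+1}`; since `p + 1 ≤ p +
    -- r - T` holds exactly when `r ≥ T + 1`, this is where the page number comes from.
    have : p + r + 1 - r ≤ p + r - T := by omega
    exact hF _ _ _ this hz
  converges r hr p k := by
    -- Both sides are quotients of the cocycles in `F^p`. The isomorphism comes from equality of the
    -- two kernels, which also makes it respect classes of cocycles.
    let C : Submodule ℝ (K k) := F p k ⊓ LinearMap.ker (d k)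
    let f : C →ₗ[ℝ] Page d F r p k := (Submodule.mkQ _).comp
      (Submodule.inclusion (show C ≤ cycles d F r p k from fun z hz => ⟨hz.1, by
        change d k z ∈ F (p + r) (k + 1)
        rw [LinearMap.mem_ker.1 hz.2]
        exact Submodule.zero_mem _⟩))
    let g : C →ₗ[ℝ] GrCohomology d F p k := (Submodule.mkQ _).comp
      (((Submodule.mkQ _).comp (Submodule.inclusion (show C ≤ LinearMap.ker (d k) from
        inf_le_right))).codRestrict (cohomologyFiltration d F p k)
        fun z => ⟨⟨z.1, z.2.2⟩, z.2.1, rfl⟩)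
    have hfs : Function.Surjective f := by
      intro y
      obtain ⟨⟨x, hx⟩, rfl⟩ := Submodule.Quotient.mk_surjective _ y
      -- The cocycle `x - z` represents the same class as `x`, since `z` lies in `F^{p+1}` with `dz
      -- = dx ∈ F^{p+r}`.
      obtain ⟨z, hz, hzx⟩ := hT (p + r) k x hx.2
      have hz1 : z ∈ F (p + 1) k := hF _ _ _ (by omega) hz
      refine ⟨⟨x - z, sub_mem hx.1 (hF _ _ _ (Nat.le_succ p) hz1), ?_⟩, ?_⟩
      · change d k (x - z) = 0
        rw [map_sub, hzx, sub_self]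
      · refine (Submodule.Quotient.eq _).2 (Submodule.mem_sup_left ?_)
        have : x - z - x = -z := by abel
        change x - z - x ∈ _
        rw [this]
        refine neg_mem ⟨hz1, ?_⟩
        change d k z ∈ F (p + r) (k + 1)
        rw [hzx]
        exact hx.2
    have hgs : Function.Surjective g := by
      intro y
      obtain ⟨⟨_, ⟨z, hzk⟩, hz, rfl⟩, rfl⟩ := Submodule.Quotient.mk_surjective _ y
      exact ⟨⟨z, hz, hzk⟩, rfl⟩
    have hker : LinearMap.ker f = LinearMap.ker g := by
      ext ⟨z, hzF, hzk⟩
      have hfz : f ⟨z, hzF, hzk⟩ = 0 ↔ z ∈ pageDenom d F r p k :=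
        Submodule.Quotient.mk_eq_zero _
      have hgz : g ⟨z, hzF, hzk⟩ = 0 ↔
          (Submodule.Quotient.mk ⟨z, hzk⟩ : Cohomology d k) ∈ cohomologyFiltration d F (p + 1) k :=
        Submodule.Quotient.mk_eq_zero _
      rw [LinearMap.mem_ker, LinearMap.mem_ker, hfz, hgz]
      constructor
      · intro h
        obtain ⟨u, hu, w, hw, rfl⟩ := Submodule.mem_sup.1 h
        have hwe : w ∈ exactElements d k := by
          cases k with
          | zero => exact hw
          | succ k =>
            obtain ⟨w, -, rfl⟩ := hw.2
            exact ⟨w, rfl⟩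
        have hdw : d k w = 0 := by
          cases k with
          | zero => rw [(Submodule.mem_bot ℝ).1 hw, map_zero]
          | succ k =>
            obtain ⟨w, -, rfl⟩ := hw.2
            exact hd k w
        have hdu : d k u = 0 := by
          have := LinearMap.mem_ker.1 hzk
          rwa [map_add, hdw, add_zero] at this
        refine ⟨⟨u, hdu⟩, hu.1, (Submodule.Quotient.eq _).2 ?_⟩
        change u - (u + w) ∈ exactElements d k
        have : u - (u + w) = -w := by abel
        rw [this]
        exact neg_mem hwe
      · rintro ⟨⟨u, hdu⟩, hu, huz⟩
        have h1 : u - z ∈ exactElements d k :=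
          (Submodule.Quotient.eq ((exactElements d k).submoduleOf (LinearMap.ker (d k)))).1 huz
        have hu' : u ∈ F (p + 1) k := hu
        refine Submodule.mem_sup.2 ⟨u, ⟨hu', ?_⟩, z - u, ?_, by abel⟩
        · change d k u ∈ F (p + r) (k + 1)
          rw [LinearMap.mem_ker.1 hdu]
          exact Submodule.zero_mem _
        · have h2 : z - u ∈ exactElements d k := by
            rw [← neg_sub]
            exact neg_mem h1
          have h3 : z - u ∈ F p k := sub_mem hzF (hF _ _ _ (Nat.le_succ p) hu')
          cases k with
          | zero => exact h2
          | succ k =>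
            obtain ⟨w, hw⟩ := h2
            rw [← hw] at h3 ⊢
            -- The denominator asks for a primitive in `F^{p+1-r}`, while an exact element only
            -- supplies some primitive. Strictness replaces it by one in `F^{p-T}`, and `p + 1 - r ≤
            -- p - T` also for truncated subtraction.
            obtain ⟨w', hw', hww⟩ := hT p k w h3
            exact ⟨h3, w', hF _ _ _ (by omega) hw', hww⟩
    let e := (f.quotKerEquivOfSurjective hfs).symm.trans
      ((Submodule.quotEquivOfEq _ _ hker).trans (g.quotKerEquivOfSurjective hgs))
    refine ⟨e, fun z hz hdz => ?_⟩
    have h1 : (f.quotKerEquivOfSurjective hfs).symm (pageClass r z hz hdz) =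
        Submodule.Quotient.mk ⟨z, hz, hdz⟩ := by
      rw [LinearEquiv.symm_apply_eq]
      rfl
    change (Submodule.quotEquivOfEq _ _ hker).trans (g.quotKerEquivOfSurjective hgs)
      ((f.quotKerEquivOfSurjective hfs).symm (pageClass r z hz hdz)) = _
    rw [h1]
    rfl

end Criterion

/-- Since `ω` has even degree, `ω ∧ θ = θ ∧ ω`, so the structure equation `dω = -ω ∧ θ` is the
closedness of `ω` for the twist `1`. -/
lemma LCSManifold.lichD_omega {n : ℕ} {M : Type*} [TopologicalSpace M]
    [ChartedSpace (EuclideanSpace ℝ (Fin (2 * n))) M] [IsManifold (𝓡 (2 * n)) ∞ M]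
    (X : LCSManifold n M) : lichD X.theta 1 X.omega = 0 := by
  have h : lichD X.theta 1 X.omega =
    extD X.omega + ((1 : ℤ) : ℝ) • (X.theta.wedge X.omega).cast (Nat.add_comm 1 2) := rfl
  have h2 : X.omega.wedge X.theta = (X.theta.wedge X.omega).cast (Nat.add_comm 1 2) := by
    ext1
    funext x
    refine (wedge_eq_wedgeOne (V := EuclideanSpace ℝ (Fin (2 * n))) (X.omega.1 x)
      (X.theta.1 x)).trans ?_
    rw [neg_one_sq]
    exact one_smul ℝ (wedgeOne (V := EuclideanSpace ℝ (Fin (2 * n))) (X.theta.1 x) (X.omega.1 x))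
  rw [h, X.d_omega, h2, Int.cast_one, one_smul]
  exact neg_add_cancel (G := Form (EuclideanSpace ℝ (Fin (2 * n))) M (2 + 1)) _

end LCS

end

theorem theorem5p4 (n : ℕ) (M : Type*) [TopologicalSpace M] [T2Space M]
    [SecondCountableTopology M] [ChartedSpace (EuclideanSpace ℝ (Fin (2 * n))) M]
    [IsManifold (𝓡 (2 * n)) ∞ M] (X : LCS.LCSManifold n M) (T : ℕ) (hT : 2 ≤ T)
    (ρ : LCS.Form (EuclideanSpace ℝ (Fin (2 * n))) M (2 * T - 1))
    (hρ : (X.d T (2 * T - 1) ρ).cast (by omega) = LCS.omegaPow X.omega T) (l : ℤ) :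
    X.SpectralSequenceStabilizesAt l (T + 1) := by
  -- With `T = t + 1` the degree `2 * T - 1` reduces to `2 * t + 1` and the cast in `hρ` becomes
  -- definitionally trivial.
  obtain ⟨t, rfl⟩ := Nat.exists_eq_add_of_le' (show 1 ≤ T by omega)
  refine LCS.stabilizesAt_of_strict (X.d_d l)
    (fun p q k h => LCS.lefschetzFiltration_antitone X.omega h k) (t + 1) fun p k α hα => ?_
  exact LCS.exists_primitive_of_omegaPow_exact X.nondegenerate finrank_euclideanSpace_fin
    X.lichD_omega X.d_theta ρ hρ l p α hα
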